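/- Let $u>0$ be real and consider the Painlevé I spectral curve on $\mathbb{P}^1$, $$x(z)=z^2-2u,\qquad y(z)=z^3-3uz,\qquad \omega_{0,2}(z_1,z_2)=\frac{dz_1\,dz_2}{(z_1-z_2)^2},$$ whose only ramification point is $z=0$, with Galois involution $z\mapsto -z$. For $i\ge 0$ put $$\theta(z)=\frac{-2}{(y(z)-y(-z))\,dx(z)}=\Bigl(\sum_{m\ge 0}\theta_m z^{2m-2}\Bigr)\frac1{dz},\qquad e_i(z)=\frac{z^{2i+1}}{(2i+1)!!},\qquad \xi^i(z)=\operatorname*{Res}_{w=0}\Bigl(\int_0^w\omega_{0,2}(z,\cdot)\Bigr)\frac{(2i+1)!!}{w^{2i+2}}\,dw,$$ and let $$A_{i,j,k}=\operatorname*{Res}_{z=0}\theta e_i\,de_j\,de_k,\quad B_{i,j}^k=\operatorname*{Res}_{z=0}\theta e_i\,de_j\,\xi^k,\quad C_i^{j,k}=\operatorname*{Res}_{z=0}\theta e_i\,\xi^j\xi^k,\quad D_i=\delta_{i,0}\frac{\theta_1}{8}+\delta_{i,1}\frac{\theta_0}{24}$$ be the associated quantum Airy structure. Its amplitudes $F^{\mathrm{PI}}_{g;k_1,\dots,k_n}(u)$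 ($g\ge 0$, $n\ge 1$, $k_i\ge 0$) are determined by $F_{0;i}=F_{0;i,j}=0$, $F_{0;i,j,k}=A_{i,j,k}$, $F_{1;i}=D_i$ and, for all other $(g,n)$ with $2g-2+n>0$, $$F_{g;k_1,\dots,k_n}=\sum_{m=2}^n\sum_{\mu\ge 0}B_{k_1,k_m}^{\mu}F_{g;\mu,k_2,\dots,\widehat{k_m},\dots,k_n}+\frac12\sum_{\mu,\nu\ge 0}C_{k_1}^{\mu,\nu}\Bigl(F_{g-1;\mu,\nu,k_2,\dots,k_n}+\sum_{\substack{g_1+g_2=g\\ I_1\sqcup I_2=\{k_2,\dots,k_n\}}}F_{g_1;\mu,I_1}F_{g_2;\nu,I_2}\Bigr)$$ (terms with $g-1<0$ are zero; the sums over $\mu,\nu$ have finitely many nonzero terms). For $n=0$ and $g\ge 2$, $F^{\mathrm{PI}}_g(u)$ is the free energy $$F_g=\frac{1}{2-2g}\operatorname*{Res}_{z=0}\Bigl(\int_0^z y\,dx\Bigr)\sum_{i\ge 0}F_{g;i}\,\xi^i(z).$$ Define $$P(u)=\begin{cases}\dfrac{2}{5u^2}&\text{if }u<\tfrac25,\\[2mm]\dfrac{5}{10u-2}&\text{if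 }u\ge\tfrac25.\end{cases}$$ Then for every $u>0$ we have $P(u)>0$ and there is a constant $S(u)>0$, depending only on $u$, such that for all integers $g,n\ge 0$ with $2g-2+n>0$ and all integers $k_1,\dots,k_n\ge 0$, $$F^{\mathrm{PI}}_{g;k_1,\dots,k_n}(u)\prod_{i=1}^n(2k_i+1)!!\;\le\; S(u)\Bigl(\frac{2u}{27}\Bigr)^{g}P(u)^{3g-3+n}\,\frac{(3g-3+n)!}{g!}.$$ -/

import Mathlib

open scoped LaurentSeries PowerSeries Nat

/-- Tensors `(A, B, C, D)` of a quantum Airy structure on the vector space with basis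
`(e_i)_{i ≥ 0}`; `B i j k` is `B_{i,j}^k` and `C i j k` is `C_i^{j,k}`. -/
structure AiryTensors (K : Type*) where
  A : ℕ → ℕ → ℕ → K
  B : ℕ → ℕ → ℕ → K
  C : ℕ → ℕ → ℕ → K
  D : ℕ → K

/-- All ways to distribute the entries of a list over two lists (one for each subset of positions),
that is, the ordered decompositions `I₁ ⊔ I₂` of the family of entries. -/
def listSplits {α : Type*} : List α → List (List α × List α)
  | [] => [([], [])]
  | a :: l => (listSplits l).map (fun s => (a :: s.1, s.2)) ++
      (listSplits l).map (fun s => (s.1, a :: s.2))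

theorem length_of_mem_listSplits {α : Type*} {l : List α} {s : List α × List α}
    (h : s ∈ listSplits l) : s.1.length + s.2.length = l.length := by
  induction l generalizing s with
  | nil => simp_all [listSplits]
  | cons a l ih =>
    simp only [listSplits, List.mem_append, List.mem_map] at h
    rcases h with ⟨t, ht, rfl⟩ | ⟨t, ht, rfl⟩ <;>
      · have := ih ht
        simp only [List.length_cons]
        omega

namespace AiryTensors

/-- The amplitudes `F_{g;i₁,…,iₙ}`, `n ≥ 1`, of a quantum Airy structure, defined by recursion on
`2g - 2 + n`. The guard `2 < 2 g' + n'` in the product terms leaves out factors with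
`(g',n') = (0,1), (0,2)`, which vanish; see `amplitude_rec` for the recursion without guards.
The value at the empty list is a dummy: free energies (`n = 0`) are defined separately. -/
noncomputable def amplitude {K : Type*} [Field K] (Q : AiryTensors K) : ℕ → List ℕ → K
  | _, [] => 0
  | 0, [_] => 0
  | 0, [_, _] => 0
  | 0, [i, j, k] => Q.A i j k
  | 1, [i] => Q.D i
  | g, i :: l =>
    (∑ m : Fin l.length, ∑ᶠ μ : ℕ, Q.B i (l.get m) μ * Q.amplitude g (μ :: l.eraseIdx m)) +
    1 / 2 * ∑ᶠ p : ℕ × ℕ, Q.C i p.1 p.2 *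
      ((if _h : 0 < g then Q.amplitude (g - 1) (p.1 :: p.2 :: l) else 0) +
        ∑ q : Finset.HasAntidiagonal.antidiagonal g, ((listSplits l).attach.map (fun s =>
          if _h : 2 < 2 * q.1.1 + (s.1.1.length + 1) ∧ 2 < 2 * q.1.2 + (s.1.2.length + 1) then
            Q.amplitude q.1.1 (p.1 :: s.1.1) * Q.amplitude q.1.2 (p.2 :: s.1.2)
          else 0)).sum)
termination_by g l => 2 * g + l.length
decreasing_by
  · have := m.2
    simp only [List.length_cons, List.length_eraseIdx, this, if_true]
    omega
  · simp only [List.length_cons]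
    omega
  · have h1 := length_of_mem_listSplits s.2
    have h2 := Finset.HasAntidiagonal.mem_antidiagonal.mp q.2
    simp only [List.length_cons]
    omega
  · have h1 := length_of_mem_listSplits s.2
    have h2 := Finset.HasAntidiagonal.mem_antidiagonal.mp q.2
    simp only [List.length_cons]
    omega

variable {K : Type*} [Field K] (Q : AiryTensors K)

theorem amplitude_eq_zero_of_unstable (g : ℕ) (l : List ℕ) (h : 2 * g + l.length ≤ 2) :
    Q.amplitude g l = 0 := by
  match g, l, h with
  | _, [], _ => simp [amplitude]
  | 0, [_], _ => simp [amplitude]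
  | 0, [_, _], _ => simp [amplitude]
  | 0, _ :: _ :: _ :: _, h => simp at h
  | g + 1, _ :: _, h => simp at h; omega

/-- The recursion for the amplitudes in its usual form. -/
theorem amplitude_rec (g i : ℕ) (l : List ℕ) (h : 2 < 2 * g + (i :: l).length)
    (h03 : ¬(g = 0 ∧ l.length = 2)) (h11 : ¬(g = 1 ∧ l.length = 0)) :
    Q.amplitude g (i :: l) =
      (∑ m : Fin l.length, ∑ᶠ μ : ℕ, Q.B i (l.get m) μ * Q.amplitude g (μ :: l.eraseIdx m)) +
      1 / 2 * ∑ᶠ p : ℕ × ℕ, Q.C i p.1 p.2 *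
        ((if 0 < g then Q.amplitude (g - 1) (p.1 :: p.2 :: l) else 0) +
          ∑ q ∈ Finset.HasAntidiagonal.antidiagonal g, ((listSplits l).map (fun s =>
            Q.amplitude q.1 (p.1 :: s.1) * Q.amplitude q.2 (p.2 :: s.2))).sum) := by
  rw [amplitude]
  · congr 2
    refine finsum_congr fun p => ?_
    congr 2
    rw [← Finset.sum_coe_sort (Finset.HasAntidiagonal.antidiagonal g)]
    refine Finset.sum_congr rfl fun q _ => ?_
    conv_rhs => rw [← List.attach_map_subtype_val (listSplits l), List.map_map]
    congr 1
    refine List.map_congr_left fun s _ => ?_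
    simp only [Function.comp]
    split_ifs with hs
    · rfl
    · rw [not_and_or] at hs
      rcases hs with hs | hs
      · rw [amplitude_eq_zero_of_unstable Q _ (p.1 :: s.1.1) (by simpa using hs), zero_mul]
      · rw [amplitude_eq_zero_of_unstable Q _ (p.2 :: s.1.2) (by simpa using hs), mul_zero]
  all_goals
    intros
    subst_vars
    simp_all

end AiryTensors

/-- The primitive `∫₀^X f` of a formal power series. -/
noncomputable def primitive {R : Type*} [Field R] (f : R⟦X⟧) : R⟦X⟧ :=
  PowerSeries.mk fun n => if n = 0 then 0 else PowerSeries.coeff (n - 1) f / n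

/-- The residue at `ζ = 0` of the 1-form `f dζ`. -/
def residue {K : Type*} [Field K] (f : K⸨X⸩) : K := f.coeff (-1)

/-- The expansion of a spectral curve with a single (simple) ramification point, at that point, in
the local coordinate `ζ` for which `x = x₀ + ζ²`. The bidifferential is
`ω_{0,2} = (1 / (ζ₁ - ζ₂)² + ∑ b m₁ m₂ ζ₁^{m₁} ζ₂^{m₂}) dζ₁ dζ₂`. -/
structure OnePointCurve (K : Type*) [Field K] where
  x₀ : K
  y : K⟦X⟧
  b : ℕ → ℕ → K
  b_symm : ∀ m₁ m₂, b m₁ m₂ = b m₂ m₁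

namespace OnePointCurve

variable {K : Type*} [Field K] (S : OnePointCurve K)

noncomputable def x : K⟦X⟧ := PowerSeries.C S.x₀ + PowerSeries.X ^ 2

/-- `θ = -2 / ((y(ζ) - y(σ(ζ))) dx(ζ))` with `σ(ζ) = -ζ`, as the coefficient of `1 / dζ`. -/
noncomputable def theta : K⸨X⸩ :=
  -2 / (((S.y - PowerSeries.evalNegHom S.y) * PowerSeries.derivative K S.x : K⟦X⟧) : K⸨X⸩)

/-- The coefficients in `θ = (∑ θ_m ζ^{2m-2}) / dζ`. -/
noncomputable def thetaCoeff (m : ℕ) : K := S.theta.coeff (2 * (m : ℤ) - 2)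

/-- The even coefficients `φ_{m₁,m₂}` of the regular part of `ω_{0,2}`. -/
def phi (m₁ m₂ : ℕ) : K := S.b (2 * m₁) (2 * m₂)

/-- `ω_{0,2}(z, w) / (dz dw)`, expanded at `w = 0` with coefficients Laurent series in `z`. -/
noncomputable def omega02 : K⸨X⸩⟦X⟧ :=
  ((PowerSeries.C (HahnSeries.single (1 : ℤ) (1 : K)) - PowerSeries.X) ^ 2)⁻¹ +
    PowerSeries.mk fun m₂ => ((PowerSeries.mk fun m₁ => S.b m₁ m₂ : K⟦X⟧) : K⸨X⸩)

/-- `ξ^i(z) = Res_{w = 0} (∫₀^w ω_{0,2}(z, ·)) (2i+1)!! / w^{2i+2} dw`, as the coefficient of `dz`;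
the residue in `w` is the coefficient of `w^{2i+1}` of the primitive times `(2i+1)!!`. -/
noncomputable def xi (i : ℕ) : K⸨X⸩ :=
  PowerSeries.coeff (2 * i + 1) (primitive S.omega02) * (((2 * i + 1)‼ : ℕ) : K⸨X⸩)

/-- `e_i = ζ^{2i+1} / (2i+1)!!`. -/
noncomputable def e (K : Type*) [Field K] (i : ℕ) : K⟦X⟧ :=
  PowerSeries.monomial (2 * i + 1) (1 / (((2 * i + 1)‼ : ℕ) : K))

/-- `d e_i`, as the coefficient of `dζ`. -/
noncomputable def de (K : Type*) [Field K] (i : ℕ) : K⟦X⟧ := PowerSeries.derivative K (e K i)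

/-- The quantum Airy structure of the spectral curve. -/
noncomputable def airy : AiryTensors K where
  A i j k := residue (S.theta * (e K i : K⸨X⸩) * (de K j : K⸨X⸩) * (de K k : K⸨X⸩))
  B i j k := residue (S.theta * (e K i : K⸨X⸩) * (de K j : K⸨X⸩) * S.xi k)
  C i j k := residue (S.theta * (e K i : K⸨X⸩) * S.xi j * S.xi k)
  D i := (if i = 0 then S.thetaCoeff 0 / 2 * S.phi 0 0 + S.thetaCoeff 1 / 8 else 0) +
    (if i = 1 then S.thetaCoeff 0 / 24 else 0)

/-- The correlator `ω_{g,1} = ∑ F_{g;i} ξ^i`, as the coefficient of `dz`. -/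
noncomputable def omega1 (g : ℕ) : K⸨X⸩ := ∑ᶠ i : ℕ, S.airy.amplitude g [i] • S.xi i

/-- The free energy `F_g = 1 / (2 - 2g) · Res_{z = 0} (∫₀^z y dx) ω_{g,1}(z)`, `g ≥ 2`. -/
noncomputable def freeEnergy (g : ℕ) : K :=
  1 / (2 - 2 * (g : K)) *
    residue ((primitive (S.y * PowerSeries.derivative K S.x) : K⸨X⸩) * S.omega1 g)

/-- The amplitudes `F_{g;k₁,…,kₙ}` of the spectral curve, including the free energies `F_g` for
`n = 0`. -/
noncomputable def F (g : ℕ) {n : ℕ} (k : Fin n → ℕ) : K :=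
  if n = 0 then S.freeEnergy g else S.airy.amplitude g (List.ofFn k)

end OnePointCurve

/-- The Painlevé I spectral curve `x = z² - 2u`, `y = z³ - 3uz`, `ω_{0,2} = dz₁ dz₂ / (z₁ - z₂)²`
on the projective line, whose only ramification point is `z = 0`, with `ζ = z`. -/
noncomputable def painleveI {K : Type*} [Field K] (u : K) : OnePointCurve K where
  x₀ := -2 * u
  y := PowerSeries.X ^ 3 - PowerSeries.C (3 * u) * PowerSeries.X
  b _ _ := 0
  b_symm _ _ := rfl

/-- The exponential growth rate `P(u)`. -/
noncomputable def growthP (u : ℝ) : ℝ :=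
  if u < 2 / 5 then 2 / (5 * u ^ 2) else 5 / (10 * u - 2)

/-- The sum of `f k (K \ {k})` over the entries `k` of the multiset `K`. -/
def tailSum (K : Multiset ℕ) (f : ℕ → Multiset ℕ → ℝ) : ℝ :=
  (K.map fun k => f k (K.erase k)).sum

/-- The sum of `f I J` over the ordered decompositions `K = I + J`. -/
def splitSum (K : Multiset ℕ) (f : Multiset ℕ → Multiset ℕ → ℝ) : ℝ :=
  (K.antidiagonal.map fun s => f s.1 s.2).sum

@[simp] theorem tailSum_zero (f : ℕ → Multiset ℕ → ℝ) : tailSum 0 f = 0 := by simp [tailSum]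

theorem tailSum_cons (a : ℕ) (K : Multiset ℕ) (f : ℕ → Multiset ℕ → ℝ) :
    tailSum (a ::ₘ K) f = f a K + tailSum K fun k L => f k (a ::ₘ L) := by
  simp only [tailSum, Multiset.map_cons, Multiset.sum_cons, Multiset.erase_cons_head]
  congr 2
  refine Multiset.map_congr rfl fun k hk => ?_
  rw [Multiset.erase_cons_tail_of_mem hk]

@[simp] theorem splitSum_zero (f : Multiset ℕ → Multiset ℕ → ℝ) : splitSum 0 f = f 0 0 := by
  simp [splitSum]

theorem splitSum_cons (a : ℕ) (K : Multiset ℕ) (f : Multiset ℕ → Multiset ℕ → ℝ) :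
    splitSum (a ::ₘ K) f =
      splitSum K (fun I J => f (a ::ₘ I) J) + splitSum K (fun I J => f I (a ::ₘ J)) := by
  simp [splitSum, Multiset.antidiagonal_cons, Multiset.map_map, add_comm]

theorem tailSum_congr {K : Multiset ℕ} {f f' : ℕ → Multiset ℕ → ℝ}
    (h : ∀ k L, k ::ₘ L = K → f k L = f' k L) : tailSum K f = tailSum K f' := by
  refine congrArg Multiset.sum (Multiset.map_congr rfl fun k hk => h _ _ ?_)
  exact Multiset.cons_erase hk

theorem splitSum_congr {K : Multiset ℕ} {f f' : Multiset ℕ → Multiset ℕ → ℝ}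
    (h : ∀ I J, I + J = K → f I J = f' I J) : splitSum K f = splitSum K f' := by
  refine congrArg Multiset.sum (Multiset.map_congr rfl fun s hs => h _ _ ?_)
  exact Multiset.mem_antidiagonal.mp hs

theorem tailSum_mono {K : Multiset ℕ} {f f' : ℕ → Multiset ℕ → ℝ}
    (h : ∀ k L, k ::ₘ L = K → f k L ≤ f' k L) : tailSum K f ≤ tailSum K f' :=
  Multiset.sum_map_le_sum_map _ _ fun _ hk => h _ _ (Multiset.cons_erase hk)

theorem splitSum_mono {K : Multiset ℕ} {f f' : Multiset ℕ → Multiset ℕ → ℝ}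
    (h : ∀ I J, I + J = K → f I J ≤ f' I J) : splitSum K f ≤ splitSum K f' :=
  Multiset.sum_map_le_sum_map _ _ fun _ hs => h _ _ (Multiset.mem_antidiagonal.mp hs)

theorem tailSum_add (K : Multiset ℕ) (f f' : ℕ → Multiset ℕ → ℝ) :
    tailSum K (fun k L => f k L + f' k L) = tailSum K f + tailSum K f' :=
  Multiset.sum_map_add

theorem splitSum_add (K : Multiset ℕ) (f f' : Multiset ℕ → Multiset ℕ → ℝ) :
    splitSum K (fun I J => f I J + f' I J) = splitSum K f + splitSum K f' :=
  Multiset.sum_map_add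

theorem tailSum_mul_left (K : Multiset ℕ) (c : ℝ) (f : ℕ → Multiset ℕ → ℝ) :
    tailSum K (fun k L => c * f k L) = c * tailSum K f :=
  Multiset.sum_map_mul_left

theorem splitSum_mul_left (K : Multiset ℕ) (c : ℝ) (f : Multiset ℕ → Multiset ℕ → ℝ) :
    splitSum K (fun I J => c * f I J) = c * splitSum K f :=
  Multiset.sum_map_mul_left

theorem tailSum_mul_right (K : Multiset ℕ) (c : ℝ) (f : ℕ → Multiset ℕ → ℝ) :
    tailSum K (fun k L => f k L * c) = tailSum K f * c :=
  Multiset.sum_map_mul_right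

@[simp] theorem tailSum_const_zero (K : Multiset ℕ) : tailSum K (fun _ _ => 0) = 0 := by
  simp [tailSum]

@[simp] theorem splitSum_const_zero (K : Multiset ℕ) : splitSum K (fun _ _ => 0) = 0 := by
  simp [splitSum]

theorem tailSum_sum {ι : Type*} (K : Multiset ℕ) (s : Finset ι) (f : ι → ℕ → Multiset ℕ → ℝ) :
    tailSum K (fun k L => ∑ i ∈ s, f i k L) = ∑ i ∈ s, tailSum K (f i) := by
  classical
  induction s using Finset.induction_on with
  | empty => simp
  | insert a s ha ih => simp only [Finset.sum_insert ha, tailSum_add, ih]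

theorem splitSum_sum {ι : Type*} (K : Multiset ℕ) (s : Finset ι)
    (f : ι → Multiset ℕ → Multiset ℕ → ℝ) :
    splitSum K (fun I J => ∑ i ∈ s, f i I J) = ∑ i ∈ s, splitSum K (f i) := by
  classical
  induction s using Finset.induction_on with
  | empty => simp
  | insert a s ha ih => simp only [Finset.sum_insert ha, splitSum_add, ih]

theorem tailSum_nonneg {K : Multiset ℕ} {f : ℕ → Multiset ℕ → ℝ}
    (h : ∀ k L, k ::ₘ L = K → 0 ≤ f k L) : 0 ≤ tailSum K f := by
  simpa using tailSum_mono h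

theorem splitSum_nonneg {K : Multiset ℕ} {f : Multiset ℕ → Multiset ℕ → ℝ}
    (h : ∀ I J, I + J = K → 0 ≤ f I J) : 0 ≤ splitSum K f := by
  simpa using splitSum_mono h

theorem tailSum_comm (K : Multiset ℕ) (f : ℕ → ℕ → Multiset ℕ → ℝ) :
    tailSum K (fun k L => tailSum L fun k' L' => f k k' L') =
      tailSum K (fun k L => tailSum L fun k' L' => f k' k L') := by
  induction K using Multiset.induction_on generalizing f with
  | empty => simp
  | cons a K ih =>
    simp only [tailSum_cons, tailSum_add]
    rw [ih fun k k' L => f k k' (a ::ₘ L)]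
    ring

theorem splitSum_swap (K : Multiset ℕ) (f : Multiset ℕ → Multiset ℕ → ℝ) :
    splitSum K (fun I J => f J I) = splitSum K f := by
  induction K using Multiset.induction_on generalizing f with
  | empty => simp
  | cons a K ih =>
    simp only [splitSum_cons]
    rw [ih fun I J => f I (a ::ₘ J), ih fun I J => f (a ::ₘ I) J, add_comm]

theorem splitSum_tailSum_left (K : Multiset ℕ) (f : ℕ → Multiset ℕ → Multiset ℕ → ℝ) :
    splitSum K (fun I J => tailSum I fun k I' => f k I' J) =
      tailSum K (fun k L => splitSum L fun I J => f k I J) := by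
  induction K using Multiset.induction_on generalizing f with
  | empty => simp
  | cons a K ih =>
    simp only [tailSum_cons, splitSum_cons, splitSum_add, tailSum_add]
    rw [ih fun k I J => f k (a ::ₘ I) J, ih fun k I J => f k I (a ::ₘ J)]
    ring

theorem tailSum_const (K : Multiset ℕ) (a b c : ℝ) :
    tailSum K (fun k _ => (a * (k : ℝ) + b) * c) = (a * (K.sum : ℝ) + b * K.card) * c := by
  induction K using Multiset.induction_on with
  | empty => simp
  | cons k K ih =>
    rw [tailSum_cons, ih]
    simp only [Multiset.sum_cons, Multiset.card_cons, Nat.cast_add, Nat.cast_one]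
    ring

/-- The value `f (n - 1)`, with the convention that it is zero for `n = 0`. -/
def shiftDown (f : ℕ → ℝ) : ℕ → ℝ
  | 0 => 0
  | n + 1 => f n

@[simp] theorem shiftDown_zero (f : ℕ → ℝ) : shiftDown f 0 = 0 := rfl

@[simp] theorem shiftDown_succ (f : ℕ → ℝ) (n : ℕ) : shiftDown f (n + 1) = f n := rfl

theorem shiftDown_mul_left (c : ℝ) (f : ℕ → ℝ) (n : ℕ) :
    shiftDown (fun m => c * f m) n = c * shiftDown f n := by
  cases n <;> simp

/-- The sum of `f μ ν` over `μ + ν = i - 2`, zero for `i < 2`. -/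
def pairSum (f : ℕ → ℕ → ℝ) : ℕ → ℝ
  | 0 => 0
  | 1 => 0
  | i + 2 => ∑ p ∈ Finset.HasAntidiagonal.antidiagonal i, f p.1 p.2

@[simp] theorem pairSum_zero (f : ℕ → ℕ → ℝ) : pairSum f 0 = 0 := rfl

@[simp] theorem pairSum_one (f : ℕ → ℕ → ℝ) : pairSum f 1 = 0 := rfl

theorem pairSum_add_two (f : ℕ → ℕ → ℝ) (i : ℕ) :
    pairSum f (i + 2) = ∑ p ∈ Finset.HasAntidiagonal.antidiagonal i, f p.1 p.2 := rfl

theorem pairSum_congr {f f' : ℕ → ℕ → ℝ} (i : ℕ)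
    (h : ∀ μ ν, μ + ν + 2 = i → f μ ν = f' μ ν) : pairSum f i = pairSum f' i := by
  match i with
  | 0 => rfl
  | 1 => rfl
  | i + 2 =>
    refine Finset.sum_congr rfl fun p hp => h _ _ ?_
    rw [Finset.HasAntidiagonal.mem_antidiagonal.mp hp]

theorem pairSum_add (f f' : ℕ → ℕ → ℝ) (i : ℕ) :
    pairSum (fun μ ν => f μ ν + f' μ ν) i = pairSum f i + pairSum f' i := by
  match i with
  | 0 => simp
  | 1 => simp
  | i + 2 => exact Finset.sum_add_distrib

theorem pairSum_mul_left (c : ℝ) (f : ℕ → ℕ → ℝ) (i : ℕ) :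
    pairSum (fun μ ν => c * f μ ν) i = c * pairSum f i := by
  match i with
  | 0 => simp
  | 1 => simp
  | i + 2 => exact (Finset.mul_sum _ _ _).symm

theorem pairSum_swap (f : ℕ → ℕ → ℝ) (i : ℕ) :
    pairSum (fun μ ν => f ν μ) i = pairSum f i := by
  match i with
  | 0 => simp
  | 1 => simp
  | i + 2 => exact Finset.Nat.sum_antidiagonal_swap (f := fun p => f p.1 p.2)

theorem pairSum_nonneg {f : ℕ → ℕ → ℝ} (i : ℕ)
    (h : ∀ μ ν, μ + ν + 2 = i → 0 ≤ f μ ν) : 0 ≤ pairSum f i := by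
  match i with
  | 0 => simp
  | 1 => simp
  | i + 2 =>
    refine Finset.sum_nonneg fun p hp => h _ _ ?_
    rw [Finset.HasAntidiagonal.mem_antidiagonal.mp hp]

theorem tailSum_pairSum (K : Multiset ℕ) (f : ℕ → Multiset ℕ → ℕ → ℕ → ℝ) (i : ℕ) :
    tailSum K (fun k L => pairSum (f k L) i) =
      pairSum (fun μ ν => tailSum K fun k L => f k L μ ν) i := by
  match i with
  | 0 => simp
  | 1 => simp
  | i + 2 => simp only [pairSum_add_two, tailSum_sum]

theorem pairSum_shiftDown_left (f : ℕ → ℕ → ℝ) (i : ℕ) :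
    pairSum (fun μ ν => (2 * (μ : ℝ) + 1) * shiftDown (fun m => f m ν) μ) (i + 1) =
      pairSum (fun μ ν => (2 * (μ : ℝ) + 3) * f μ ν) i := by
  match i with
  | 0 => simp
  | 1 => simp [pairSum]
  | i + 2 =>
    rw [show i + 2 + 1 = (i + 1) + 2 by ring, pairSum_add_two, pairSum_add_two,
      Finset.Nat.sum_antidiagonal_succ]
    simp only [shiftDown_zero, mul_zero, zero_add, shiftDown_succ]
    refine Finset.sum_congr rfl fun p _ => ?_
    push_cast
    ring

theorem pairSum_shiftDown (f : ℕ → ℕ → ℝ) (i : ℕ) :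
    pairSum (fun μ ν => (2 * (μ : ℝ) + 1) * shiftDown (fun m => f m ν) μ +
      (2 * (ν : ℝ) + 1) * shiftDown (fun m => f μ m) ν) (i + 1) =
      2 * ((i : ℝ) + 1) * pairSum f i := by
  rw [pairSum_add, pairSum_shiftDown_left,
    ← pairSum_swap (fun μ ν => (2 * (ν : ℝ) + 1) * shiftDown (fun m => f μ m) ν),
    pairSum_shiftDown_left fun μ ν => f ν μ,
    ← pairSum_swap (fun μ ν => (2 * (μ : ℝ) + 3) * f ν μ), ← pairSum_add, ← pairSum_mul_left]
  refine pairSum_congr _ fun μ ν h => ?_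
  rw [← h]
  push_cast
  ring

/-- The quadratic part of the recursion: the loop term and the product terms. -/
def quadTerm (G : ℕ → ℕ → Multiset ℕ → ℝ) (g μ ν : ℕ) (K : Multiset ℕ) : ℝ :=
  (if g = 0 then 0 else G (g - 1) μ (ν ::ₘ K)) +
    ∑ q ∈ Finset.HasAntidiagonal.antidiagonal g, splitSum K fun I J => G q.1 μ I * G q.2 ν J

/-- Virasoro constraints, solved for the first index, for amplitudes normalised by double
factorials. -/
structure IsHeadRecursive (u : ℝ) (G : ℕ → ℕ → Multiset ℕ → ℝ) : Prop where
  support : ∀ g i K, 3 * g + K.card < i + K.sum + 2 → G g i K = 0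
  head : ∀ g i K, 6 * u * G g i K = 2 * G g (i + 1) K +
    tailSum K (fun k L => (2 * (k : ℝ) + 1) * shiftDown (fun m => G g m L) (i + k)) +
    1 / 2 * pairSum (fun μ ν => quadTerm G g μ ν K) i +
    (if g = 0 ∧ i = 0 ∧ K = {0, 0} then 1 else 0) +
    (if g = 1 ∧ i = 1 ∧ K = 0 then 1 / 8 else 0)

/-- Induction on `2g + n`, then downwards on the sum of the indices. -/
theorem amplitude_induction {P : ℕ → ℕ → Multiset ℕ → Prop}
    (base : ∀ g i K, 3 * g + K.card ≤ i + K.sum → P g i K)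
    (step : ∀ g i K, (∀ g' i' K', 2 * g' + K'.card < 2 * g + K.card → P g' i' K') →
      (∀ i' K', K'.card = K.card → i + K.sum < i' + K'.sum → P g i' K') → P g i K)
    (g i : ℕ) (K : Multiset ℕ) : P g i K := by
  suffices h : ∀ N c g i K, 2 * g + Multiset.card K = N → 3 * g + K.card ≤ i + K.sum + c →
      P g i K from h _ (3 * g + K.card) g i K rfl (by omega)
  intro N
  induction N using Nat.strong_induction_on with
  | _ N ihN =>
    intro c
    induction c with
    | zero => exact fun g i K _ h => base g i K (by omega)
    | succ c ihc =>
      intro g i K hN hc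
      refine step g i K (fun g' i' K' h => ihN _ (by omega) (3 * g' + K'.card) g' i' K' rfl
        (by omega)) fun i' K' hK h => ihc g i' K' (by omega) (by omega)

namespace IsHeadRecursive

variable {u : ℝ} {G : ℕ → ℕ → Multiset ℕ → ℝ}

theorem disk_eq_zero (hG : IsHeadRecursive u G) (ν : ℕ) : G 0 ν 0 = 0 :=
  hG.support 0 ν 0 (by simp)

/-- If inserting `a` into smaller amplitudes acts as `R`, it acts on the quadratic part by the
Leibniz rule. -/
theorem quadTerm_cons (hG : IsHeadRecursive u G) (a : ℕ) (R : ℕ → ℕ → Multiset ℕ → ℝ)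
    (g : ℕ) (K : Multiset ℕ)
    (hR : ∀ g' i' K', 2 * g' + K'.card < 2 * g + K.card → 6 * u * G g' i' (a ::ₘ K') = R g' i' K')
    (μ ν : ℕ) :
    6 * u * quadTerm G g μ ν (a ::ₘ K) = (if g = 0 then 0 else R (g - 1) μ (ν ::ₘ K)) +
      ∑ q ∈ Finset.HasAntidiagonal.antidiagonal g, splitSum K fun I J =>
        R q.1 μ I * G q.2 ν J + G q.1 μ I * R q.2 ν J := by
  rw [quadTerm, mul_add]
  congr 1
  · split_ifs with h
    · simp
    · rw [Multiset.cons_swap, hR _ _ _ (by rw [Multiset.card_cons]; omega)]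
  · rw [Finset.mul_sum]
    refine Finset.sum_congr rfl fun q hq => ?_
    rw [Finset.HasAntidiagonal.mem_antidiagonal] at hq
    rw [splitSum_cons, ← splitSum_add, ← splitSum_mul_left]
    refine splitSum_congr fun I J hIJ => ?_
    have hc : I.card + J.card = K.card := by rw [← hIJ, Multiset.card_add]
    have h1 : 6 * u * G q.1 μ (a ::ₘ I) * G q.2 ν J = R q.1 μ I * G q.2 ν J := by
      by_cases h : 2 * q.1 + I.card < 2 * g + K.card
      · rw [hR _ _ _ h]
      · have hJ : J = 0 := Multiset.card_eq_zero.mp (by omega)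
        have h2 : q.2 = 0 := by omega
        rw [hJ, h2, hG.disk_eq_zero]
        ring
    have h2 : G q.1 μ I * (6 * u * G q.2 ν (a ::ₘ J)) = G q.1 μ I * R q.2 ν J := by
      by_cases h : 2 * q.2 + J.card < 2 * g + K.card
      · rw [hR _ _ _ h]
      · have hI : I = 0 := Multiset.card_eq_zero.mp (by omega)
        have h2 : q.1 = 0 := by omega
        rw [hI, h2, hG.disk_eq_zero]
        ring
    linear_combination h1 + h2

/-- The dilaton equation: removal of an index `1`. -/
theorem dilaton (hG : IsHeadRecursive u G) (hu : u ≠ 0) (g i : ℕ) (K : Multiset ℕ) :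
    6 * u * G g i (1 ::ₘ K) = 2 * G g i (2 ::ₘ K) +
      (2 * (i : ℝ) + 1 + (2 * (K.sum : ℝ) + K.card)) * G g i K := by
  induction g, i, K using amplitude_induction with
  | base g i K h =>
    rw [hG.support g i (1 ::ₘ K), hG.support g i (2 ::ₘ K), hG.support g i K]
    · ring
    all_goals (try simp only [Multiset.card_cons, Multiset.sum_cons]); omega
  | step g i K ih1 ih2 =>
    set e : ℝ := 2 * (i : ℝ) + 1 + (2 * (K.sum : ℝ) + K.card) with he
    have hA : 6 * u * G g (i + 1) (1 ::ₘ K) = 2 * G g (i + 1) (2 ::ₘ K) +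
        (e + 2) * G g (i + 1) K := by
      rw [ih2 (i + 1) K rfl (by omega), he]
      push_cast
      ring
    have hB : 6 * u * tailSum K (fun k L => (2 * (k : ℝ) + 1) *
          shiftDown (fun m => G g m (1 ::ₘ L)) (i + k)) =
        2 * tailSum K (fun k L => (2 * (k : ℝ) + 1) *
          shiftDown (fun m => G g m (2 ::ₘ L)) (i + k)) +
        (e - 3) * tailSum K (fun k L => (2 * (k : ℝ) + 1) *
          shiftDown (fun m => G g m L) (i + k)) := by
      rw [← tailSum_mul_left, ← tailSum_mul_left, ← tailSum_mul_left, ← tailSum_add]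
      refine tailSum_congr fun k L hL => ?_
      rcases hik : i + k with _ | m
      · simp
      · have := ih1 g m L (by rw [← hL, Multiset.card_cons]; omega)
        have hm : (i : ℝ) + k = m + 1 := by exact_mod_cast hik
        rw [← hL] at he
        simp only [Multiset.sum_cons, Multiset.card_cons, Nat.cast_add, Nat.cast_one] at he
        simp only [shiftDown_succ]
        linear_combination (2 * (k : ℝ) + 1) * this -
          (2 * (k : ℝ) + 1) * G g m L * (he + 2 * hm)
    have hC : 6 * u * pairSum (fun μ ν => quadTerm G g μ ν (1 ::ₘ K)) i =
        2 * pairSum (fun μ ν => quadTerm G g μ ν (2 ::ₘ K)) i +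
        (e - 3) * pairSum (fun μ ν => quadTerm G g μ ν K) i := by
      rw [← pairSum_mul_left, ← pairSum_mul_left, ← pairSum_mul_left, ← pairSum_add]
      refine pairSum_congr i fun μ ν hi => ?_
      have hi' : (μ : ℝ) + ν + 2 = i := by exact_mod_cast hi
      rw [hG.quadTerm_cons 1 _ g K ih1]
      simp only [quadTerm, splitSum_cons, ← splitSum_add, mul_add, Finset.mul_sum,
        ← splitSum_mul_left]
      refine Eq.trans ?_ (add_add_add_comm _ _ _ _)
      rw [← Finset.sum_add_distrib]
      congr 1
      · split_ifs
        · simp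
        · rw [Multiset.cons_swap 2 ν, he]
          simp only [Multiset.sum_cons, Multiset.card_cons, Nat.cast_add, Nat.cast_one]
          linear_combination (2 * G (g - 1) μ (ν ::ₘ K)) * hi'
      · refine Finset.sum_congr rfl fun q _ => ?_
        rw [← splitSum_add]
        refine splitSum_congr fun I J hIJ => ?_
        rw [he, ← hIJ]
        simp only [Multiset.sum_add, Multiset.card_add, Nat.cast_add]
        linear_combination (2 * G q.1 μ I * G q.2 ν J) * hi'
    have hL := hG.head g i (1 ::ₘ K)
    have hR := hG.head g i (2 ::ₘ K)
    have h0 := hG.head g i K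
    have n1 : (1 ::ₘ K) ≠ {0, 0} := fun h => by
      have : 1 ∈ ({0, 0} : Multiset ℕ) := h ▸ Multiset.mem_cons_self 1 K
      simp at this
    have n2 : (2 ::ₘ K) ≠ {0, 0} := fun h => by
      have : 2 ∈ ({0, 0} : Multiset ℕ) := h ▸ Multiset.mem_cons_self 2 K
      simp at this
    simp only [tailSum_cons, n1, n2, Multiset.cons_ne_zero, and_false, if_false, add_zero,
      shiftDown_succ, Nat.cast_one, Nat.cast_ofNat, show i + 2 = (i + 1) + 1 by ring] at hL hR
    have hd : (e - 3) * ((if g = 0 ∧ i = 0 ∧ K = {0, 0} then 1 else 0) +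
        (if g = 1 ∧ i = 1 ∧ K = 0 then 1 / 8 else 0)) = 0 := by
      split_ifs with h1 h2 h2
      · omega
      · rw [he, h1.2.1, h1.2.2]
        norm_num
      · rw [he, h2.2.1, h2.2.2]
        norm_num
      · simp
    refine mul_left_cancel₀ (mul_ne_zero (by norm_num : (6 : ℝ) ≠ 0) hu) ?_
    linear_combination (6 * u) * hL - 2 * hR - (e - 3) * h0 + 2 * hA + hB + 1 / 2 * hC - hd

end IsHeadRecursive

theorem shiftDown_comm (f : ℕ → ℕ → ℝ) (a b : ℕ) :
    shiftDown (fun m => shiftDown (fun m' => f m m') b) a =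
      shiftDown (fun m' => shiftDown (fun m => f m m') a) b := by
  cases a <;> cases b <;> simp

theorem shiftDown_tailSum (K : Multiset ℕ) (f : ℕ → ℕ → Multiset ℕ → ℝ) (a : ℕ) :
    shiftDown (fun m => tailSum K (f m)) a =
      tailSum K fun k L => shiftDown (fun m => f m k L) a := by
  cases a <;> simp

theorem splitSum_ite_empty (K : Multiset ℕ) (f : Multiset ℕ → ℝ) :
    splitSum K (fun I J => if I = 0 then f J else 0) = f K := by
  induction K using Multiset.induction_on generalizing f with
  | empty => simp
  | cons a K ih => simp [splitSum_cons, ih fun J => f (a ::ₘ J)]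

theorem cons_eq_singleton_zero_iff (a : ℕ) (I : Multiset ℕ) :
    a ::ₘ I = {0} ↔ a = 0 ∧ I = 0 := by
  rw [← Multiset.cons_zero, Multiset.cons_eq_cons]
  aesop

theorem cons_eq_pair_zero_iff (a : ℕ) (I : Multiset ℕ) :
    a ::ₘ I = {0, 0} ↔ a = 0 ∧ I = {0} := by
  constructor
  · intro h
    have ha : a = 0 := by
      have : a ∈ ({0, 0} : Multiset ℕ) := h ▸ Multiset.mem_cons_self a I
      simpa using this
    subst ha
    exact ⟨rfl, (Multiset.cons_inj_right 0).mp h⟩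
  · rintro ⟨rfl, rfl⟩
    rfl

theorem splitSum_ite_singleton (K : Multiset ℕ) (f : Multiset ℕ → ℝ) :
    splitSum K (fun I J => if I = {0} then f J else 0) =
      tailSum K fun k L => if k = 0 then f L else 0 := by
  induction K using Multiset.induction_on generalizing f with
  | empty => simp
  | cons a K ih =>
    rw [splitSum_cons, tailSum_cons, ih fun J => f (a ::ₘ J)]
    congr 1
    simp only [cons_eq_singleton_zero_iff]
    by_cases ha : a = 0
    · simp [ha, splitSum_ite_empty]
    · simp [ha]

theorem pairSum_ite_left (h : ℕ → ℝ) (i : ℕ) :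
    pairSum (fun μ ν => if μ = 0 then h ν else 0) i = shiftDown (shiftDown h) i := by
  match i with
  | 0 => rfl
  | 1 => rfl
  | i + 2 =>
    rw [pairSum_add_two, Finset.sum_eq_single (0, i)]
    · simp
    · rintro ⟨a, b⟩ hp hne
      rw [Finset.HasAntidiagonal.mem_antidiagonal] at hp
      refine if_neg fun ha => hne ?_
      simp only at ha hp
      ext <;> simp <;> omega
    · intro hp
      simp at hp

theorem pairSum_ite_right (h : ℕ → ℝ) (i : ℕ) :
    pairSum (fun μ ν => if ν = 0 then h μ else 0) i = shiftDown (shiftDown h) i := by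
  rw [← pairSum_ite_left, ← pairSum_swap]

/-- The right-hand side of the string equation. -/
def stringTerm (G : ℕ → ℕ → Multiset ℕ → ℝ) (g i : ℕ) (K : Multiset ℕ) : ℝ :=
  2 * G g i (1 ::ₘ K) + (2 * (i : ℝ) + 1) * shiftDown (fun m => G g m K) i +
    tailSum K (fun k L => (2 * (k : ℝ) + 1) * shiftDown (fun m => G g i (m ::ₘ L)) k) +
    (if g = 0 ∧ i = 0 ∧ K = {0} then 1 else 0)

theorem splitSum_stringTerm_left (G : ℕ → ℕ → Multiset ℕ → ℝ) (a b μ ν : ℕ) (K : Multiset ℕ) :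
    splitSum K (fun I J => stringTerm G a μ I * G b ν J) =
      2 * splitSum K (fun I J => G a μ (1 ::ₘ I) * G b ν J) +
      (2 * (μ : ℝ) + 1) * shiftDown (fun m => splitSum K fun I J => G a m I * G b ν J) μ +
      tailSum K (fun k L => (2 * (k : ℝ) + 1) *
        shiftDown (fun m => splitSum L fun I J => G a μ (m ::ₘ I) * G b ν J) k) +
      (if a = 0 ∧ μ = 0 then tailSum K (fun k L => if k = 0 then G b ν L else 0) else 0) := by
  have h1 : (2 * (μ : ℝ) + 1) * shiftDown (fun m => splitSum K fun I J => G a m I * G b ν J) μ =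
      splitSum K fun I J => (2 * (μ : ℝ) + 1) * (shiftDown (fun m => G a m I) μ * G b ν J) := by
    rw [splitSum_mul_left]
    cases μ <;> simp
  have h2 : tailSum K (fun k L => (2 * (k : ℝ) + 1) *
        shiftDown (fun m => splitSum L fun I J => G a μ (m ::ₘ I) * G b ν J) k) =
      splitSum K fun I J => tailSum I (fun k L => (2 * (k : ℝ) + 1) *
        shiftDown (fun m => G a μ (m ::ₘ L)) k) * G b ν J := by
    simp only [← tailSum_mul_right]
    rw [splitSum_tailSum_left K fun k I J => (2 * (k : ℝ) + 1) *
        shiftDown (fun m => G a μ (m ::ₘ I)) k * G b ν J]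
    refine tailSum_congr fun k L _ => ?_
    simp only [mul_assoc, splitSum_mul_left]
    cases k <;> simp
  have h3 : (if a = 0 ∧ μ = 0 then tailSum K (fun k L => if k = 0 then G b ν L else 0) else 0) =
      splitSum K fun I J => (if a = 0 ∧ μ = 0 ∧ I = {0} then 1 else 0) * G b ν J := by
    rw [← splitSum_ite_singleton]
    split_ifs with h
    · simp [h.1, h.2]
    · symm
      simp only [← and_assoc, h, false_and, if_false, zero_mul, splitSum_const_zero]
  rw [h1, h2, h3, ← splitSum_mul_left, ← splitSum_add, ← splitSum_add, ← splitSum_add]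
  refine splitSum_congr fun I J _ => ?_
  rw [stringTerm]
  ring

theorem splitSum_stringTerm_right (G : ℕ → ℕ → Multiset ℕ → ℝ) (a b μ ν : ℕ) (K : Multiset ℕ) :
    splitSum K (fun I J => G a μ I * stringTerm G b ν J) =
      2 * splitSum K (fun I J => G a μ I * G b ν (1 ::ₘ J)) +
      (2 * (ν : ℝ) + 1) * shiftDown (fun m => splitSum K fun I J => G a μ I * G b m J) ν +
      tailSum K (fun k L => (2 * (k : ℝ) + 1) *
        shiftDown (fun m => splitSum L fun I J => G a μ I * G b ν (m ::ₘ J)) k) +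
      (if b = 0 ∧ ν = 0 then tailSum K (fun k L => if k = 0 then G a μ L else 0) else 0) := by
  have h := splitSum_stringTerm_left G b a ν μ K
  have sw : ∀ (L : Multiset ℕ) (f f' : Multiset ℕ → ℝ),
      splitSum L (fun I J => f I * f' J) = splitSum L (fun I J => f' I * f J) := by
    intro L f f'
    rw [← splitSum_swap]
    exact splitSum_congr fun I J _ => mul_comm _ _
  rw [sw K (G a μ) (stringTerm G b ν), h, sw K (fun I => G b ν (1 ::ₘ I)) (G a μ)]
  simp only [sw _ _ (G a μ)]

theorem sum_antidiagonal_ite_left (g : ℕ) (p : Prop) [Decidable p] (c : ℕ → ℝ) :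
    ∑ q ∈ Finset.HasAntidiagonal.antidiagonal g, (if q.1 = 0 ∧ p then c q.2 else 0) =
      if p then c g else 0 := by
  rw [Finset.sum_eq_single (0, g)]
  · simp
  · rintro ⟨a, b⟩ hp hne
    rw [Finset.HasAntidiagonal.mem_antidiagonal] at hp
    refine if_neg fun ha => hne ?_
    simp only at ha hp
    ext <;> simp <;> omega
  · intro hp
    simp at hp

theorem sum_antidiagonal_ite_right (g : ℕ) (p : Prop) [Decidable p] (c : ℕ → ℝ) :
    ∑ q ∈ Finset.HasAntidiagonal.antidiagonal g, (if q.2 = 0 ∧ p then c q.1 else 0) =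
      if p then c g else 0 := by
  rw [← sum_antidiagonal_ite_left g p c]
  exact (Finset.Nat.sum_antidiagonal_swap
    (f := fun q : ℕ × ℕ => if q.2 = 0 ∧ p then c q.1 else 0)).symm

theorem shiftDown_add (f f' : ℕ → ℝ) (n : ℕ) :
    shiftDown (fun m => f m + f' m) n = shiftDown f n + shiftDown f' n := by
  cases n <;> simp

theorem shiftDown_sum {ι : Type*} (s : Finset ι) (f : ι → ℕ → ℝ) (n : ℕ) :
    shiftDown (fun m => ∑ q ∈ s, f q m) n = ∑ q ∈ s, shiftDown (f q) n := by
  cases n <;> simp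

/-- The string operator acts on the quadratic part by lowering one of the two summed indices or
one of the external indices, up to a contribution of the string anomaly. -/
theorem quadTerm_stringTerm (G : ℕ → ℕ → Multiset ℕ → ℝ) (g μ ν : ℕ) (K : Multiset ℕ) :
    (if g = 0 then 0 else stringTerm G (g - 1) μ (ν ::ₘ K)) +
      ∑ q ∈ Finset.HasAntidiagonal.antidiagonal g, splitSum K (fun I J =>
        stringTerm G q.1 μ I * G q.2 ν J + G q.1 μ I * stringTerm G q.2 ν J) =
    2 * quadTerm G g μ ν (1 ::ₘ K) +
      ((2 * (μ : ℝ) + 1) * shiftDown (fun m => quadTerm G g m ν K) μ +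
        (2 * (ν : ℝ) + 1) * shiftDown (fun m => quadTerm G g μ m K) ν) +
      tailSum K (fun k L => (2 * (k : ℝ) + 1) *
        shiftDown (fun m => quadTerm G g μ ν (m ::ₘ L)) k) +
      ((if μ = 0 then tailSum K (fun k L => if k = 0 then G g ν L else 0) else 0) +
        (if ν = 0 then tailSum K (fun k L => if k = 0 then G g μ L else 0) else 0)) +
      (if μ = 0 then (if g = 1 ∧ ν = 0 ∧ K = 0 then 1 else 0) else 0) := by
  have hprod : ∑ q ∈ Finset.HasAntidiagonal.antidiagonal g, splitSum K (fun I J =>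
        stringTerm G q.1 μ I * G q.2 ν J + G q.1 μ I * stringTerm G q.2 ν J) =
      2 * ∑ q ∈ Finset.HasAntidiagonal.antidiagonal g, splitSum (1 ::ₘ K) (fun I J =>
        G q.1 μ I * G q.2 ν J) +
      ((2 * (μ : ℝ) + 1) * shiftDown (fun m => ∑ q ∈ Finset.HasAntidiagonal.antidiagonal g,
          splitSum K fun I J => G q.1 m I * G q.2 ν J) μ +
        (2 * (ν : ℝ) + 1) * shiftDown (fun m => ∑ q ∈ Finset.HasAntidiagonal.antidiagonal g,
          splitSum K fun I J => G q.1 μ I * G q.2 m J) ν) +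
      tailSum K (fun k L => (2 * (k : ℝ) + 1) *
        shiftDown (fun m => ∑ q ∈ Finset.HasAntidiagonal.antidiagonal g,
          splitSum (m ::ₘ L) fun I J => G q.1 μ I * G q.2 ν J) k) +
      ((if μ = 0 then tailSum K (fun k L => if k = 0 then G g ν L else 0) else 0) +
        (if ν = 0 then tailSum K (fun k L => if k = 0 then G g μ L else 0) else 0)) := by
    rw [← sum_antidiagonal_ite_left g (μ = 0)
        fun b => tailSum K (fun k L => if k = 0 then G b ν L else 0),
      ← sum_antidiagonal_ite_right g (ν = 0)
        fun a => tailSum K (fun k L => if k = 0 then G a μ L else 0)]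
    simp only [shiftDown_sum, Finset.mul_sum, tailSum_sum, ← Finset.sum_add_distrib]
    refine Finset.sum_congr rfl fun q _ => ?_
    rw [splitSum_add, splitSum_stringTerm_left, splitSum_stringTerm_right]
    simp only [splitSum_cons, shiftDown_add, mul_add, tailSum_add]
    ring
  have hloop : (if g = 0 then 0 else stringTerm G (g - 1) μ (ν ::ₘ K)) =
      2 * (if g = 0 then 0 else G (g - 1) μ (ν ::ₘ 1 ::ₘ K)) +
      ((2 * (μ : ℝ) + 1) * shiftDown (fun m => if g = 0 then 0 else G (g - 1) m (ν ::ₘ K)) μ +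
        (2 * (ν : ℝ) + 1) * shiftDown (fun m => if g = 0 then 0 else G (g - 1) μ (m ::ₘ K)) ν) +
      tailSum K (fun k L => (2 * (k : ℝ) + 1) *
        shiftDown (fun m => if g = 0 then 0 else G (g - 1) μ (ν ::ₘ m ::ₘ L)) k) +
      (if μ = 0 then (if g = 1 ∧ ν = 0 ∧ K = 0 then 1 else 0) else 0) := by
    by_cases hg : g = 0
    · have hz : ∀ n, shiftDown (fun _ => 0) n = 0 := fun n => by cases n <;> rfl
      simp [hg, hz]
    · simp only [hg, if_false, stringTerm, tailSum_cons, cons_eq_singleton_zero_iff,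
        Multiset.cons_swap ν]
      have : (if g - 1 = 0 ∧ μ = 0 ∧ ν = 0 ∧ K = 0 then (1 : ℝ) else 0) =
          (if μ = 0 then (if g = 1 ∧ ν = 0 ∧ K = 0 then 1 else 0) else 0) := by
        have : g - 1 = 0 ↔ g = 1 := by omega
        simp only [this]
        split_ifs <;> first | rfl | tauto
      rw [this]
      ring
  rw [hprod, hloop]
  simp only [quadTerm, shiftDown_add, mul_add, tailSum_add]
  ring

theorem string_anomaly (g i : ℕ) (K : Multiset ℕ) :
    tailSum K (fun k L => (2 * (k : ℝ) + 1) *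
      shiftDown (fun m => if g = 0 ∧ m = 0 ∧ L = {0} then 1 else 0) (i + k)) =
    tailSum K (fun k L => (2 * (k : ℝ) + 1) *
      shiftDown (fun m => if g = 0 ∧ i = 0 ∧ m ::ₘ L = {0, 0} then 1 else 0) k) +
    2 * (i : ℝ) * shiftDown (fun m => if g = 0 ∧ m = 0 ∧ K = {0, 0} then 1 else 0) i := by
  match i with
  | 0 =>
    rw [shiftDown_zero, mul_zero, add_zero]
    refine tailSum_congr fun k L _ => ?_
    rcases k with _ | k
    · simp
    · simp only [cons_eq_pair_zero_iff, zero_add, shiftDown_succ, true_and]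
  | 1 =>
    by_cases hK : g = 0 ∧ K = {0, 0}
    · obtain ⟨rfl, rfl⟩ := hK
      rw [show ({0, 0} : Multiset ℕ) = 0 ::ₘ 0 ::ₘ 0 from rfl]
      simp only [tailSum_cons, tailSum_zero]
      norm_num [Nat.cast_zero, shiftDown]
    · have h1 : ∀ k L, k ::ₘ L = K → (2 * (k : ℝ) + 1) *
          shiftDown (fun m => if g = 0 ∧ m = 0 ∧ L = {0} then 1 else 0) (1 + k) = 0 := by
        intro k L hL
        rw [add_comm 1 k, shiftDown_succ, if_neg, mul_zero]
        rintro ⟨hg, hk⟩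
        exact hK ⟨hg, by rw [← hL, cons_eq_pair_zero_iff]; exact hk⟩
      have h2 : ∀ k L, k ::ₘ L = K → (2 * (k : ℝ) + 1) *
          shiftDown (fun m => if g = 0 ∧ 1 = 0 ∧ m ::ₘ L = {0, 0} then 1 else 0) k = 0 := by
        intro k L _
        rcases k with _ | k <;> simp
      rw [tailSum_congr h1, tailSum_congr h2]
      have h3 : ¬ (g = 0 ∧ 0 = 0 ∧ K = {0, 0}) := by tauto
      rw [tailSum_const_zero, shiftDown_succ, if_neg h3]
      simp
  | i + 2 =>
    have h1 : ∀ k L, k ::ₘ L = K → (2 * (k : ℝ) + 1) *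
        shiftDown (fun m => if g = 0 ∧ m = 0 ∧ L = {0} then 1 else 0) (i + 2 + k) = 0 := by
      intro k L _
      rw [show i + 2 + k = (i + 1 + k) + 1 by ring, shiftDown_succ, if_neg (by omega), mul_zero]
    have h2 : ∀ k L, k ::ₘ L = K → (2 * (k : ℝ) + 1) *
        shiftDown (fun m => if g = 0 ∧ i + 2 = 0 ∧ m ::ₘ L = {0, 0} then 1 else 0) k = 0 := by
      intro k L _
      rcases k with _ | k <;> simp
    rw [tailSum_congr h1, tailSum_congr h2]
    simp

namespace IsHeadRecursive

variable {u : ℝ} {G : ℕ → ℕ → Multiset ℕ → ℝ}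

/-- The string equation: removal of an index `0`. -/
theorem string (hG : IsHeadRecursive u G) (hu : u ≠ 0) (g i : ℕ) (K : Multiset ℕ) :
    6 * u * G g i (0 ::ₘ K) = stringTerm G g i K := by
  induction g, i, K using amplitude_induction with
  | base g i K h =>
    have h1 : shiftDown (fun m => G g m K) i = 0 := by
      rcases i with _ | i
      · rfl
      · exact hG.support _ _ _ (by omega)
    have h2 : ∀ k L, k ::ₘ L = K →
        (2 * (k : ℝ) + 1) * shiftDown (fun m => G g i (m ::ₘ L)) k = 0 := by
      rintro k L rfl
      rcases k with _ | k
      · simp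
      · rw [shiftDown_succ, hG.support, mul_zero]
        simp only [Multiset.card_cons, Multiset.sum_cons] at h ⊢
        omega
    have h3 : ¬(g = 0 ∧ i = 0 ∧ K = {0}) := by
      rintro ⟨rfl, rfl, rfl⟩
      simp at h
    rw [stringTerm, h1, tailSum_congr h2, if_neg h3, hG.support, hG.support]
    · simp
    all_goals simp only [Multiset.card_cons, Multiset.sum_cons]; omega
  | step g i K ih1 ih2 =>
    have hA := ih2 (i + 1) K rfl (by omega)
    rw [stringTerm, shiftDown_succ] at hA
    simp only [Nat.add_eq_zero_iff, one_ne_zero, and_false, false_and, if_false, add_zero,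
      Nat.cast_add, Nat.cast_one] at hA
    have hB : 6 * u * tailSum K (fun k L => (2 * (k : ℝ) + 1) *
          shiftDown (fun m => G g m (0 ::ₘ L)) (i + k)) =
        2 * tailSum K (fun k L => (2 * (k : ℝ) + 1) *
          shiftDown (fun m => G g m (1 ::ₘ L)) (i + k)) +
        tailSum K (fun k L => (2 * (k : ℝ) + 1) *
          shiftDown (fun m => (2 * (m : ℝ) + 1) * shiftDown (fun m => G g m L) m) (i + k)) +
        tailSum K (fun k L => (2 * (k : ℝ) + 1) * shiftDown (fun m => tailSum L
          fun k' L' => (2 * (k' : ℝ) + 1) * shiftDown (fun m' => G g m (m' ::ₘ L')) k') (i + k)) +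
        tailSum K (fun k L => (2 * (k : ℝ) + 1) *
          shiftDown (fun m => if g = 0 ∧ m = 0 ∧ L = {0} then 1 else 0) (i + k)) := by
      rw [← tailSum_mul_left, ← tailSum_mul_left, ← tailSum_add, ← tailSum_add, ← tailSum_add]
      refine tailSum_congr fun k L hL => ?_
      rcases i + k with _ | m
      · simp
      · have := ih1 g m L (by rw [← hL, Multiset.card_cons]; omega)
        rw [stringTerm] at this
        simp only [shiftDown_succ]
        linear_combination (2 * (k : ℝ) + 1) * this
    have hC : 6 * u * pairSum (fun μ ν => quadTerm G g μ ν (0 ::ₘ K)) i =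
        2 * pairSum (fun μ ν => quadTerm G g μ ν (1 ::ₘ K)) i +
        2 * (i : ℝ) * shiftDown (pairSum fun μ ν => quadTerm G g μ ν K) i +
        tailSum K (fun k L => (2 * (k : ℝ) + 1) *
          shiftDown (fun m => pairSum (fun μ ν => quadTerm G g μ ν (m ::ₘ L)) i) k) +
        2 * tailSum K (fun k L => if k = 0 then shiftDown (shiftDown fun m => G g m L) i else 0) +
        (if g = 1 ∧ i = 2 ∧ K = 0 then 1 else 0) := by
      have hlow : 2 * (i : ℝ) * shiftDown (pairSum fun μ ν => quadTerm G g μ ν K) i =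
          pairSum (fun μ ν => (2 * (μ : ℝ) + 1) * shiftDown (fun m => quadTerm G g m ν K) μ +
            (2 * (ν : ℝ) + 1) * shiftDown (fun m => quadTerm G g μ m K) ν) i := by
        rcases i with _ | i
        · simp
        · rw [pairSum_shiftDown, shiftDown_succ]
          push_cast
          ring
      have htail : tailSum K (fun k L => (2 * (k : ℝ) + 1) *
            shiftDown (fun m => pairSum (fun μ ν => quadTerm G g μ ν (m ::ₘ L)) i) k) =
          pairSum (fun μ ν => tailSum K (fun k L => (2 * (k : ℝ) + 1) *
            shiftDown (fun m => quadTerm G g μ ν (m ::ₘ L)) k)) i := by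
        rw [← tailSum_pairSum]
        refine tailSum_congr fun k L _ => ?_
        rw [pairSum_mul_left]
        rcases k with _ | k
        · simp only [shiftDown_zero]
          match i with
          | 0 => simp
          | 1 => simp
          | i + 2 => simp [pairSum_add_two]
        · rfl
      have hzero : tailSum K
            (fun k L => if k = 0 then shiftDown (shiftDown fun m => G g m L) i else 0) =
          shiftDown (shiftDown fun m => tailSum K fun k L => if k = 0 then G g m L else 0) i := by
        rcases i with _ | _ | i <;> simp
      have hone : (if g = 1 ∧ i = 2 ∧ K = 0 then (1 : ℝ) else 0) =
          shiftDown (shiftDown fun m => if g = 1 ∧ m = 0 ∧ K = 0 then 1 else 0) i := by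
        rcases i with _ | _ | i <;> simp
      rw [hlow, htail, hzero, hone, two_mul (shiftDown _ _), ← pairSum_mul_left, ← pairSum_mul_left]
      nth_rw 2 [← pairSum_ite_right]
      rw [← pairSum_ite_left, ← pairSum_ite_left, ← pairSum_add, ← pairSum_add, ← pairSum_add,
        ← pairSum_add, ← pairSum_add]
      refine pairSum_congr i fun μ ν _ => ?_
      rw [hG.quadTerm_cons 0 _ g K ih1, quadTerm_stringTerm]
    have hR3 : 6 * u * tailSum K (fun k L => (2 * (k : ℝ) + 1) *
          shiftDown (fun m => G g i (m ::ₘ L)) k) =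
        2 * tailSum K (fun k L => (2 * (k : ℝ) + 1) *
          shiftDown (fun m => G g (i + 1) (m ::ₘ L)) k) +
        tailSum K (fun k L => (2 * (k : ℝ) + 1) *
          shiftDown (fun m => (2 * (m : ℝ) + 1) * shiftDown (fun m => G g m L) (i + m)) k) +
        tailSum K (fun k L => (2 * (k : ℝ) + 1) * shiftDown (fun m => tailSum L
          fun k' L' => (2 * (k' : ℝ) + 1) * shiftDown (fun m' => G g m' (m ::ₘ L')) (i + k')) k) +
        1 / 2 * tailSum K (fun k L => (2 * (k : ℝ) + 1) *
          shiftDown (fun m => pairSum (fun μ ν => quadTerm G g μ ν (m ::ₘ L)) i) k) +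
        tailSum K (fun k L => (2 * (k : ℝ) + 1) *
          shiftDown (fun m => if g = 0 ∧ i = 0 ∧ m ::ₘ L = {0, 0} then 1 else 0) k) := by
      rw [← tailSum_mul_left, ← tailSum_mul_left, ← tailSum_mul_left, ← tailSum_add,
        ← tailSum_add, ← tailSum_add, ← tailSum_add]
      refine tailSum_congr fun k L _ => ?_
      rcases k with _ | k
      · simp
      · have := hG.head g i (k ::ₘ L)
        simp only [tailSum_cons, Multiset.cons_ne_zero, and_false, if_false, add_zero] at this
        simp only [shiftDown_succ]
        linear_combination (2 * ((k + 1 : ℕ) : ℝ) + 1) * this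
    have hR2 : 2 * (i : ℝ) * (6 * u * shiftDown (fun m => G g m K) i) =
        4 * (i : ℝ) * G g i K +
        2 * (i : ℝ) * tailSum K (fun k L => (2 * (k : ℝ) + 1) *
          shiftDown (fun m => shiftDown (fun m => G g m L) (m + k)) i) +
        (i : ℝ) * shiftDown (pairSum fun μ ν => quadTerm G g μ ν K) i +
        2 * (i : ℝ) * shiftDown (fun m => if g = 0 ∧ m = 0 ∧ K = {0, 0} then 1 else 0) i +
        1 / 2 * (if g = 1 ∧ i = 2 ∧ K = 0 then 1 else 0) := by
      rcases i with _ | i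
      · simp
      · have := hG.head g i K
        have hone : (2 * ((i : ℝ) + 1)) * (if g = 1 ∧ i = 1 ∧ K = 0 then 1 / 8 else 0) =
            1 / 2 * (if g = 1 ∧ i + 1 = 2 ∧ K = 0 then 1 else 0) := by
          simp only [show i + 1 = 2 ↔ i = 1 by omega]
          split_ifs with h
          · rw [h.2.1]
            norm_num
          · simp
        simp only [shiftDown_succ, Nat.cast_add, Nat.cast_one]
        linear_combination (2 * ((i : ℝ) + 1)) * this + hone
    have hmB : tailSum K (fun k L => (2 * (k : ℝ) + 1) *
          shiftDown (fun m => (2 * (m : ℝ) + 1) * shiftDown (fun m => G g m L) m) (i + k)) +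
        tailSum K (fun k L => if k = 0 then shiftDown (shiftDown fun m => G g m L) i else 0) =
        tailSum K (fun k L => (2 * (k : ℝ) + 1) *
          shiftDown (fun m => (2 * (m : ℝ) + 1) * shiftDown (fun m => G g m L) (i + m)) k) +
        2 * (i : ℝ) * tailSum K (fun k L => (2 * (k : ℝ) + 1) *
          shiftDown (fun m => shiftDown (fun m => G g m L) (m + k)) i) := by
      rw [← tailSum_mul_left, ← tailSum_add, ← tailSum_add]
      refine tailSum_congr fun k L _ => ?_
      rcases k with _ | k <;> rcases i with _ | i
      · simp
      · simp
        ring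
      · simp
      · simp only [show i + 1 + (k + 1) = (i + k + 1) + 1 by ring, shiftDown_succ,
          show i + 1 + k = (i + k) + 1 by ring, show i + (k + 1) = (i + k) + 1 by ring]
        push_cast
        simp
        ring
    have hmC : tailSum K (fun k L => (2 * (k : ℝ) + 1) * shiftDown (fun m => tailSum L
          fun k' L' => (2 * (k' : ℝ) + 1) * shiftDown (fun m' => G g m (m' ::ₘ L')) k') (i + k)) =
        tailSum K (fun k L => (2 * (k : ℝ) + 1) * shiftDown (fun m => tailSum L
          fun k' L' => (2 * (k' : ℝ) + 1) * shiftDown (fun m' => G g m' (m ::ₘ L')) (i + k')) k) := by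
      simp only [shiftDown_tailSum, ← tailSum_mul_left, shiftDown_mul_left]
      rw [tailSum_comm]
      refine tailSum_congr fun k L _ => tailSum_congr fun k' L' _ => ?_
      rw [shiftDown_comm]
      ring
    have hmD := string_anomaly g i K
    have hL := hG.head g i (0 ::ₘ K)
    have hR1 := hG.head g i (1 ::ₘ K)
    have n1 : (1 ::ₘ K) ≠ {0, 0} := fun h => by
      have : 1 ∈ ({0, 0} : Multiset ℕ) := h ▸ Multiset.mem_cons_self 1 K
      simp at this
    simp only [tailSum_cons, n1, Multiset.cons_ne_zero, and_false, if_false, add_zero,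
      shiftDown_succ, Nat.cast_one, Nat.cast_zero, cons_eq_pair_zero_iff, true_and] at hL hR1
    refine mul_left_cancel₀ (mul_ne_zero (by norm_num : (6 : ℝ) ≠ 0) hu) ?_
    rw [stringTerm]
    linear_combination (6 * u) * hL + 2 * hA + hB + 1 / 2 * hC - 2 * hR1 - hR3 - hR2 + hmB + hmC +
      hmD

end IsHeadRecursive

/-- The majorant of the amplitudes of genus `h + 1` with `n` indices, where `j` is the difference
between `3 h + n` and the sum of the indices. -/
noncomputable def ampBound (t : ℝ) (h n j : ℕ) : ℝ :=
  (9 / 4) ^ h * t ^ (2 * h + n + j) * (6 / 5) ^ j * 3 ^ n * ((2 * h + n + j).factorial / j.factorial)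

theorem ampBound_nonneg {t : ℝ} (ht : 0 ≤ t) (h n j : ℕ) : 0 ≤ ampBound t h n j := by
  unfold ampBound
  positivity

theorem ampBound_succ_right (t : ℝ) (h n j : ℕ) :
    ampBound t h n (j + 1) * (j + 1) = 6 / 5 * t * (2 * h + n + j + 1) * ampBound t h n j := by
  have hj : (j.factorial : ℝ) ≠ 0 := by positivity
  have hj1 : (j : ℝ) + 1 ≠ 0 := by positivity
  rw [ampBound, ampBound, ← add_assoc, Nat.factorial_succ, Nat.factorial_succ]
  push_cast
  field_simp
  ring

theorem ampBound_succ_mid (t : ℝ) (h n j : ℕ) :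
    ampBound t h (n + 1) j = 3 * t * (2 * h + n + j + 1) * ampBound t h n j := by
  rw [ampBound, ampBound, show 2 * h + (n + 1) + j = (2 * h + n + j) + 1 by ring,
    Nat.factorial_succ]
  push_cast
  ring

theorem ampBound_succ_left (t : ℝ) (h n j : ℕ) :
    ampBound t (h + 1) n j = 3 / 4 * t * (2 * h + n + j + 2) * ampBound t h (n + 1) j := by
  rw [ampBound, ampBound, show 2 * (h + 1) + n + j = (2 * h + (n + 1) + j) + 1 by ring,
    Nat.factorial_succ]
  push_cast
  ring

theorem shiftDown_ampBound (t : ℝ) (h n j : ℕ) :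
    2 * t * (2 * h + n + j) * shiftDown (ampBound t h n) j = 5 / 3 * j * ampBound t h n j := by
  rcases j with _ | j
  · simp
  · have := ampBound_succ_right t h n j
    rw [shiftDown_succ]
    push_cast
    linear_combination (-5 / 3) * this

/-- The inductive step for the majorant. -/
theorem le_ampBound_of_step {u t c X Y E W Z : ℝ} {h n j : ℕ} (ht : 0 < t) (hc : 0 ≤ c)
    (hut : 6 * u * t = 1) (hE : 0 ≤ E)
    (hX : 6 * u * X ≤ 2 * Y + E * W + Z * (c * ampBound t h (n + 1) j))
    (hY : Y ≤ c * shiftDown (ampBound t h (n + 1)) j) (hW : W ≤ c * ampBound t h n j)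
    (hM : 5 * j + E + 3 * (t * (2 * h + n + j + 1)) * Z ≤ 3 * (2 * h + n + j + 1)) :
    X ≤ c * ampBound t h (n + 1) j := by
  have h1 := shiftDown_ampBound t h (n + 1) j
  have h2 := ampBound_succ_mid t h n j
  have hV := ampBound_nonneg ht.le h (n + 1) j
  set V := ampBound t h (n + 1) j
  have hMpos : (0 : ℝ) < 2 * h + n + j + 1 := by positivity
  set M : ℝ := 2 * h + n + j + 1 with hMdef
  have hX' : X = t * (6 * u * X) := by linear_combination -X * hut
  have h3 : M * X ≤ M * (c * V) := by
    calc M * X = M * t * (6 * u * X) := by rw [mul_assoc, ← hX']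
      _ ≤ M * t * (2 * (c * shiftDown (ampBound t h (n + 1)) j) + E * (c * ampBound t h n j) +
          Z * (c * V)) := by
        refine mul_le_mul_of_nonneg_left (hX.trans ?_) (by positivity)
        gcongr
      _ = 1 / 3 * (5 * j + E + 3 * (t * M) * Z) * (c * V) := by
        push_cast at h1
        rw [h2] at h1 ⊢
        linear_combination c * h1
      _ ≤ 1 / 3 * (3 * M) * (c * V) := by gcongr
      _ = M * (c * V) := by ring
  exact le_of_mul_le_mul_left h3 hMpos

namespace IsHeadRecursive

variable {u : ℝ} {G : ℕ → ℕ → Multiset ℕ → ℝ}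

theorem nonneg (hG : IsHeadRecursive u G) (hu : 0 < u) (g i : ℕ) (K : Multiset ℕ) :
    0 ≤ G g i K := by
  induction g, i, K using amplitude_induction with
  | base g i K h => rw [hG.support g i K (by omega)]
  | step g i K ih1 ih2 =>
    have h1 : 0 ≤ G g (i + 1) K := ih2 _ _ rfl (by omega)
    have h2 : 0 ≤ tailSum K
        (fun k L => (2 * (k : ℝ) + 1) * shiftDown (fun m => G g m L) (i + k)) := by
      refine tailSum_nonneg fun k L hL => mul_nonneg (by positivity) ?_
      rcases i + k with _ | m
      · simp
      · exact ih1 _ _ _ (by rw [← hL, Multiset.card_cons]; omega)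
    have h3 : 0 ≤ pairSum (fun μ ν => quadTerm G g μ ν K) i := by
      refine pairSum_nonneg i fun μ ν _ => add_nonneg ?_ (Finset.sum_nonneg fun q hq =>
        splitSum_nonneg fun I J hIJ => ?_)
      · split_ifs with hg
        · exact le_rfl
        · exact ih1 _ _ _ (by rw [Multiset.card_cons]; omega)
      · rw [Finset.HasAntidiagonal.mem_antidiagonal] at hq
        have hc : I.card + J.card = K.card := by rw [← hIJ, Multiset.card_add]
        by_cases hI : 2 * q.1 + I.card < 2 * g + K.card
        · by_cases hJ : 2 * q.2 + J.card < 2 * g + K.card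
          · exact mul_nonneg (ih1 _ _ _ hI) (ih1 _ _ _ hJ)
          · rw [show I = 0 from Multiset.card_eq_zero.mp (by omega), show q.1 = 0 by omega,
              hG.disk_eq_zero, zero_mul]
        · rw [show J = 0 from Multiset.card_eq_zero.mp (by omega), show q.2 = 0 by omega,
            hG.disk_eq_zero, mul_zero]
    have h4 : 0 ≤ 6 * u * G g i K := by
      rw [hG.head g i K]
      split_ifs <;> linarith
    exact nonneg_of_mul_nonneg_right h4 (by positivity)

theorem exists_zero_of_sum_lt {K : Multiset ℕ} (h : K.sum < K.card) : 0 ∈ K := by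
  by_contra h0
  have : K.card • 1 ≤ K.sum :=
    Multiset.card_nsmul_le_sum fun x hx => Nat.one_le_iff_ne_zero.mpr fun hx0 => h0 (hx0 ▸ hx)
  simp at this
  omega

theorem genus_zero_le (hG : IsHeadRecursive u G) (hu : 0 < u) (i : ℕ) (K : Multiset ℕ) (c j : ℕ)
    (hc : K.card = c + 2) (hj : i + K.sum + j = c) :
    G 0 i K ≤ 1 / (6 * u) * ampBound (1 / (6 * u)) 0 c j := by
  have ht : 0 < 1 / (6 * u) := by positivity
  have hut : 6 * u * (1 / (6 * u)) = 1 := by field_simp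
  set t := 1 / (6 * u)
  have key : ∀ g i K, g = 0 → ∀ c j, Multiset.card K = c + 2 → i + K.sum + j = c →
      G 0 i K ≤ t * ampBound t 0 c j := by
    intro g i K
    induction g, i, K using amplitude_induction with
    | base g i K h => intros; omega
    | step g i K ih1 ih2 =>
      rintro rfl c j hc hj
      have small : ∀ i' K', Multiset.card K' = c + 1 → i' + K'.sum + j + 1 = c →
          G 0 i' K' ≤ t * ampBound t 0 (c - 1) j := fun i' K' h1 h2 =>
        ih1 0 i' K' (by omega) rfl (c - 1) j (by omega) (by omega)
      have up : ∀ i' K', Multiset.card K' = c + 2 → i' + K'.sum + j = c + 1 →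
          G 0 i' K' ≤ t * shiftDown (ampBound t 0 c) j := by
        intro i' K' h1 h2
        rcases j with _ | j
        · rw [hG.support 0 i' K' (by omega)]
          simp
        · exact ih2 i' K' (by omega) (by omega) rfl c j h1 (by omega)
      have hW0 : 0 ≤ t * ampBound t 0 (c - 1) j := mul_nonneg ht.le (ampBound_nonneg ht.le _ _ _)
      rcases Nat.eq_zero_or_pos c with rfl | hcpos
      · obtain ⟨rfl, hK0, rfl⟩ : i = 0 ∧ K.sum = 0 ∧ j = 0 := by omega
        have hY := up 1 K hc (by omega)
        have h := hG.head 0 0 K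
        have hT : tailSum K (fun k L => (2 * (k : ℝ) + 1) *
            shiftDown (fun m => G 0 m L) (0 + k)) = 0 := by
          rw [← tailSum_const_zero K]
          refine tailSum_congr fun k L hL => ?_
          have : k = 0 := by
            rw [← hL, Multiset.sum_cons] at hK0
            omega
          simp [this]
        rw [hT, pairSum_zero] at h
        simp only [zero_ne_one, false_and, if_false, zero_add, shiftDown_zero] at h hY
        have h1 : 6 * u * G 0 0 K ≤ 1 := by
          rw [h]
          split_ifs <;> linarith
        calc G 0 0 K = t * (6 * u * G 0 0 K) := by linear_combination -(G 0 0 K) * hut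
          _ ≤ t * 1 := by gcongr
          _ = t * ampBound t 0 0 0 := by simp [ampBound]
      · obtain ⟨c, rfl⟩ : ∃ c', c = c' + 1 := ⟨c - 1, by omega⟩
        simp only [Nat.add_sub_cancel] at small hW0
        have fin : ∀ Y : ℝ, 6 * u * G 0 i K ≤ 2 * Y +
            (3 * ((i : ℝ) + K.sum)) * (t * ampBound t 0 c j) →
            Y ≤ t * shiftDown (ampBound t 0 (c + 1)) j → G 0 i K ≤ t * ampBound t 0 (c + 1) j := by
          intro Y hX hY
          refine le_ampBound_of_step (E := 3 * ((i : ℝ) + K.sum)) (Z := 0) ht ht.le hut (by positivity)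
            (by linarith) hY le_rfl ?_
          have : (i : ℝ) + K.sum + j = c + 1 := by exact_mod_cast hj
          rw [Nat.cast_zero]
          linarith [(Nat.cast_nonneg j : (0 : ℝ) ≤ j)]
        obtain ⟨L, rfl⟩ := Multiset.exists_cons_of_mem (exists_zero_of_sum_lt (K := K) (by omega))
        simp only [Multiset.sum_cons, zero_add, Multiset.card_cons] at hj hc fin
        refine fin _ ?_ (up i (1 ::ₘ L) (by simp; omega) (by simp; omega))
        rw [hG.string hu.ne', stringTerm, if_neg]
        · have h1 : (2 * (i : ℝ) + 1) * shiftDown (fun m => G 0 m L) i ≤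
              (3 * i) * (t * ampBound t 0 c j) := by
            rcases i with _ | i
            · simp
            · rw [shiftDown_succ]
              have := small i L (by omega) (by omega)
              push_cast
              nlinarith [(Nat.cast_nonneg i : (0 : ℝ) ≤ i), hG.nonneg hu 0 i L]
          have h2 : tailSum L (fun k L' => (2 * (k : ℝ) + 1) *
              shiftDown (fun m => G 0 i (m ::ₘ L')) k) ≤
              (3 * (L.sum : ℝ) + 0 * L.card) * (t * ampBound t 0 c j) := by
            rw [← tailSum_const]
            refine tailSum_mono fun k L' hL' => ?_
            rw [← hL'] at hc hj
            simp only [Multiset.sum_cons, Multiset.card_cons] at hc hj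
            rcases k with _ | k
            · simp
            · rw [shiftDown_succ]
              have := small i (k ::ₘ L') (by simp; omega) (by simp; omega)
              push_cast
              nlinarith [(Nat.cast_nonneg k : (0 : ℝ) ≤ k), hG.nonneg hu 0 i (k ::ₘ L')]
          linarith
        · rintro ⟨-, -, rfl⟩
          simp at hc
  exact key 0 i K rfl c j hc hj

end IsHeadRecursive

/-- The closed form of `∑ m.choose s * (p + s)! * (q + m - s)!`. -/
noncomputable def factorialConv (p q m : ℕ) : ℝ :=
  p.factorial * q.factorial * (p + q + 1 + m).factorial / (p + q + 1).factorial

theorem factorialConv_zero (p q : ℕ) : factorialConv p q 0 = p.factorial * q.factorial := by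
  have : ((p + q + 1).factorial : ℝ) ≠ 0 := by positivity
  rw [factorialConv, add_zero, mul_div_assoc, div_self this, mul_one]

theorem factorialConv_succ (p q m : ℕ) :
    factorialConv p q (m + 1) = factorialConv (p + 1) q m + factorialConv p (q + 1) m := by
  have h : ((p + q + 1).factorial : ℝ) ≠ 0 := by positivity
  have h' : ((p : ℝ) + q + 1 + 1) ≠ 0 := by positivity
  simp only [factorialConv, show p + 1 + q + 1 = (p + q + 1) + 1 by ring,
    show p + (q + 1) + 1 = (p + q + 1) + 1 by ring, Nat.factorial_succ p, Nat.factorial_succ q,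
    Nat.factorial_succ (p + q + 1), show p + q + 1 + (m + 1) = p + q + 1 + 1 + m by ring]
  push_cast
  field_simp
  ring

theorem sum_choose_factorial (p q m : ℕ) :
    ∑ r ∈ Finset.HasAntidiagonal.antidiagonal m,
      (m.choose r.1 : ℝ) * ((p + r.1).factorial * (q + r.2).factorial) = factorialConv p q m := by
  induction m generalizing p q with
  | zero => simp [factorialConv_zero]
  | succ m ih =>
    rw [Finset.sum_antidiagonal_choose_succ_mul
      (fun a b => (((p + a).factorial : ℝ) * (q + b).factorial)) m, factorialConv_succ,
      ← ih (p + 1) q, ← ih p (q + 1), add_comm]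
    congr 1
    · refine Finset.sum_congr rfl fun r hr => ?_
      rw [Nat.choose_symm_of_eq_add (Finset.HasAntidiagonal.mem_antidiagonal.mp hr).symm,
        show p + 1 + r.1 = p + (r.1 + 1) by ring]
    · refine Finset.sum_congr rfl fun r _ => ?_
      rw [show q + 1 + r.2 = q + (r.2 + 1) by ring]

theorem splitSum_factorialConv (K : Multiset ℕ) (p q m : ℕ) :
    splitSum K (fun I J => factorialConv (p + I.card) (q + J.card) m) =
      factorialConv p q (K.card + m) := by
  induction K using Multiset.induction_on generalizing m with
  | empty => simp
  | cons a K ih =>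
    rw [splitSum_cons, ← splitSum_add, Multiset.card_cons, show K.card + 1 + m = K.card + (m + 1)
      by ring, ← ih]
    refine splitSum_congr fun I J _ => ?_
    rw [factorialConv_succ, Multiset.card_cons, Multiset.card_cons]
    rfl

theorem sum_ampBound_mul (t : ℝ) (a b n m j : ℕ) :
    ∑ r ∈ Finset.HasAntidiagonal.antidiagonal j,
      ampBound t a (n + 1) r.1 * ampBound t b (m + 1) r.2 =
    (9 / 4) ^ (a + b) * t ^ (2 * (a + b) + (n + m) + 2 + j) * (6 / 5) ^ j * 3 ^ (n + m + 2) /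
      j.factorial * factorialConv (2 * a + 1 + n) (2 * b + 1 + m) j := by
  rw [← sum_choose_factorial, Finset.mul_sum]
  refine Finset.sum_congr rfl fun r hr => ?_
  have hr' := Finset.HasAntidiagonal.mem_antidiagonal.mp hr
  have hch : ((j.choose r.1 : ℕ) : ℝ) = j.factorial / (r.1.factorial * r.2.factorial) := by
    rw [← hr', Nat.cast_add_choose]
  rw [hch, ampBound, ampBound, ← hr', show 2 * a + (n + 1) + r.1 = 2 * a + 1 + n + r.1 by ring,
    show 2 * b + (m + 1) + r.2 = 2 * b + 1 + m + r.2 by ring]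
  have h1 : (r.1.factorial : ℝ) ≠ 0 := by positivity
  have h2 : (r.2.factorial : ℝ) ≠ 0 := by positivity
  have h3 : ((r.1 + r.2).factorial : ℝ) ≠ 0 := by positivity
  field_simp
  ring

/-- Comparison of two convolutions when the support of the first is bounded. -/
theorem sum_antidiagonal_le_of_shift {A B v w : ℕ → ℝ} {x X y Y i j : ℕ}
    (hB : ∀ μ, 0 ≤ B μ) (hv : ∀ r, 0 ≤ v r) (hw : ∀ r, 0 ≤ w r)
    (hA0 : ∀ μ, X < μ + x → A μ = 0) (hB0 : ∀ μ, Y < μ + y → B μ = 0)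
    (hAv : ∀ μ r, μ + x + r = X → A μ ≤ v r) (hBw : ∀ μ r, μ + y + r = Y → B μ ≤ w r)
    (hXY : X + Y = x + y + i + j) :
    ∑ p ∈ Finset.HasAntidiagonal.antidiagonal i, A p.1 * B p.2 ≤
      ∑ r ∈ Finset.HasAntidiagonal.antidiagonal j, v r.1 * w r.2 := by
  set s := (Finset.HasAntidiagonal.antidiagonal i).filter
    fun p : ℕ × ℕ => p.1 + x ≤ X ∧ p.2 + y ≤ Y
  have hs : ∀ p ∈ s, p.1 + p.2 = i ∧ p.1 + x ≤ X ∧ p.2 + y ≤ Y := fun p hp => by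
    have := Finset.mem_filter.mp hp
    exact ⟨Finset.HasAntidiagonal.mem_antidiagonal.mp this.1, this.2⟩
  let τ : ℕ × ℕ → ℕ × ℕ := fun p => (X - x - p.1, Y - y - p.2)
  calc ∑ p ∈ Finset.HasAntidiagonal.antidiagonal i, A p.1 * B p.2
      = ∑ p ∈ s, A p.1 * B p.2 := by
        refine (Finset.sum_filter_of_ne fun p _ hne => ?_).symm
        constructor
        · by_contra h
          exact hne (by rw [hA0 _ (by omega), zero_mul])
        · by_contra h
          exact hne (by rw [hB0 _ (by omega), mul_zero])
    _ ≤ ∑ p ∈ s, v (τ p).1 * w (τ p).2 := by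
        refine Finset.sum_le_sum fun p hp => ?_
        obtain ⟨-, h1, h2⟩ := hs p hp
        exact mul_le_mul (hAv _ _ (by simp only [τ]; omega)) (hBw _ _ (by simp only [τ]; omega))
          (hB _) (hv _)
    _ = ∑ r ∈ s.image τ, v r.1 * w r.2 := by
        refine (Finset.sum_image (f := fun r : ℕ × ℕ => v r.1 * w r.2) fun p hp q hq hpq => ?_).symm
        obtain ⟨h0, h1, h2⟩ := hs p hp
        obtain ⟨h0', h1', h2'⟩ := hs q hq
        simp only [τ, Prod.mk.injEq] at hpq
        ext <;> omega
    _ ≤ ∑ r ∈ Finset.HasAntidiagonal.antidiagonal j, v r.1 * w r.2 := by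
        refine Finset.sum_le_sum_of_subset_of_nonneg (fun r hr => ?_)
          fun r _ _ => mul_nonneg (hv _) (hw _)
        obtain ⟨p, hp, rfl⟩ := Finset.mem_image.mp hr
        obtain ⟨h0, h1, h2⟩ := hs p hp
        rw [Finset.HasAntidiagonal.mem_antidiagonal]
        simp only [τ]
        omega

theorem factorial_mul_factorial_le (a b : ℕ) :
    (a + 1).factorial * (b + 1).factorial ≤ (a + b + 1).factorial := by
  induction b with
  | zero => simp
  | succ b ih =>
    rw [Nat.factorial_succ (b + 1), show a + (b + 1) + 1 = (a + b + 1) + 1 by ring,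
      Nat.factorial_succ (a + b + 1)]
    calc (a + 1).factorial * ((b + 1 + 1) * (b + 1).factorial)
        = (b + 1 + 1) * ((a + 1).factorial * (b + 1).factorial) := by ring
      _ ≤ (a + b + 1 + 1) * (a + b + 1).factorial := Nat.mul_le_mul (by omega) ih

theorem factorialConv_odd_le (a b m : ℕ) :
    factorialConv (2 * a + 1) (2 * b + 1) m ≤
      (2 * (a + b) + 3 + m).factorial / ((2 * (a + b) + 3) * (2 * (a + b) + 2)) := by
  have h := factorial_mul_factorial_le (2 * a) (2 * b)
  have h' : (((2 * a + 1).factorial * (2 * b + 1).factorial : ℕ) : ℝ) ≤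
      ((2 * a + 2 * b + 1).factorial : ℕ) := by exact_mod_cast h
  have h0 : ((2 * a + 2 * b + 1).factorial : ℝ) ≠ 0 := by positivity
  rw [factorialConv, show 2 * a + 1 + (2 * b + 1) + 1 = (2 * a + 2 * b + 1) + 1 + 1 by ring,
    Nat.factorial_succ (2 * a + 2 * b + 1 + 1), Nat.factorial_succ (2 * a + 2 * b + 1),
    show 2 * (a + b) + 3 + m = 2 * a + 2 * b + 1 + 1 + 1 + m by ring]
  push_cast at h' ⊢
  rw [div_le_div_iff₀ (by positivity) (by positivity)]
  calc _ ≤ ((2 * a + 2 * b + 1).factorial : ℝ) * ((2 * a + 2 * b + 1 + 1 + 1 + m).factorial : ℝ) *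
        ((2 * (a + b) + 3) * (2 * (a + b) + 2)) := by gcongr
    _ = _ := by ring

/-- The sum of the majorants of the product terms. -/
theorem sum_splitSum_ampBound_le {t : ℝ} (ht : 0 < t) (h : ℕ) (K : Multiset ℕ) (j : ℕ) :
    ∑ q ∈ Finset.HasAntidiagonal.antidiagonal h, splitSum K (fun I J =>
      ∑ r ∈ Finset.HasAntidiagonal.antidiagonal j,
        ampBound t q.1 (I.card + 1) r.1 * ampBound t q.2 (J.card + 1) r.2) ≤
    2 / 3 / (t * (2 * h + 3)) * ampBound t (h + 1) (K.card + 1) j := by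
  set C := (9 / 4 : ℝ) ^ h * t ^ (2 * h + K.card + 2 + j) * (6 / 5) ^ j * 3 ^ (K.card + 2) /
    j.factorial with hC
  have hC0 : 0 ≤ C := by positivity
  have key : ∀ q ∈ Finset.HasAntidiagonal.antidiagonal h, splitSum K (fun I J =>
      ∑ r ∈ Finset.HasAntidiagonal.antidiagonal j,
        ampBound t q.1 (I.card + 1) r.1 * ampBound t q.2 (J.card + 1) r.2) ≤
      C * ((2 * h + 3 + (K.card + j)).factorial / ((2 * h + 3) * (2 * h + 2))) := by
    intro q hq
    rw [Finset.HasAntidiagonal.mem_antidiagonal] at hq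
    have e : splitSum K (fun I J => ∑ r ∈ Finset.HasAntidiagonal.antidiagonal j,
        ampBound t q.1 (I.card + 1) r.1 * ampBound t q.2 (J.card + 1) r.2) =
        C * factorialConv (2 * q.1 + 1) (2 * q.2 + 1) (K.card + j) := by
      rw [← splitSum_factorialConv, ← splitSum_mul_left]
      refine splitSum_congr fun I J hIJ => ?_
      have hc : I.card + J.card = K.card := by rw [← hIJ, Multiset.card_add]
      rw [sum_ampBound_mul, hq, hc]
    rw [e]
    have := factorialConv_odd_le q.1 q.2 (K.card + j)
    rw [hq] at this
    have hq' : (q.1 : ℝ) + q.2 = h := by exact_mod_cast hq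
    rw [hq'] at this
    gcongr
  refine (Finset.sum_le_card_nsmul _ _ _ key).trans (le_of_eq ?_)
  rw [Finset.Nat.card_antidiagonal, hC, ampBound, nsmul_eq_mul,
    show 2 * (h + 1) + (K.card + 1) + j = 2 * h + 3 + (K.card + j) by ring]
  have : (j.factorial : ℝ) ≠ 0 := by positivity
  push_cast
  field_simp
  ring

theorem two_mul_card_le_sum {K : Multiset ℕ} (h : ∀ k ∈ K, 2 ≤ k) : 2 * K.card ≤ K.sum := by
  have := Multiset.card_nsmul_le_sum h
  simp only [smul_eq_mul] at this
  omega

theorem two_le_of_ne {k : ℕ} (h0 : k ≠ 0) (h1 : k ≠ 1) : 2 ≤ k := by omega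

namespace IsHeadRecursive

variable {u : ℝ} {G : ℕ → ℕ → Multiset ℕ → ℝ}

/-- If all indices are at least two, the product terms only involve positive genera. -/
theorem sum_products_le (hG : IsHeadRecursive u G) (hu : 0 < u) {t : ℝ} (ht : 0 < t)
    (h i j : ℕ) (K : Multiset ℕ) (hK : ∀ k ∈ K, 2 ≤ k) (hj : i + K.sum + j = 3 * h + 2 + K.card)
    (ih : ∀ g' i' K', 2 * g' + Multiset.card K' < 2 * (h + 2) + K.card → ∀ h' j', g' = h' + 1 →
      i' + K'.sum + j' + 2 = 3 * g' + K'.card → G g' i' K' ≤ ampBound t h' (K'.card + 1) j') :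
    ∑ p ∈ Finset.HasAntidiagonal.antidiagonal i,
      ∑ q ∈ Finset.HasAntidiagonal.antidiagonal (h + 2),
        splitSum K (fun I J => G q.1 p.1 I * G q.2 p.2 J) ≤
    2 / 3 / (t * (2 * h + 3)) * ampBound t (h + 1) (K.card + 1) j := by
  trans ∑ q ∈ Finset.HasAntidiagonal.antidiagonal h, splitSum K fun I J =>
      ∑ p ∈ Finset.HasAntidiagonal.antidiagonal i, G (q.1 + 1) p.1 I * G (q.2 + 1) p.2 J
  · refine le_of_eq ?_
    rw [Finset.sum_comm]
    have hz : ∀ μ I J, I + J = K → G 0 μ I = 0 := by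
      intro μ I J hIJ
      have := two_mul_card_le_sum (K := I) fun k hk =>
        hK k (hIJ ▸ Multiset.mem_add.mpr (Or.inl hk))
      exact hG.support 0 μ I (by omega)
    rw [Finset.Nat.sum_antidiagonal_succ, Finset.Nat.sum_antidiagonal_succ']
    have h1 : ∑ p ∈ Finset.HasAntidiagonal.antidiagonal i,
        splitSum K (fun I J => G 0 p.1 I * G (h + 1 + 1) p.2 J) = 0 := by
      refine Finset.sum_eq_zero fun p _ => ?_
      rw [← splitSum_const_zero K]
      exact splitSum_congr fun I J hIJ => by rw [hz _ I J hIJ, zero_mul]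
    have h2 : ∑ p ∈ Finset.HasAntidiagonal.antidiagonal i,
        splitSum K (fun I J => G (h + 1 + 1) p.1 I * G 0 p.2 J) = 0 := by
      refine Finset.sum_eq_zero fun p _ => ?_
      rw [← splitSum_const_zero K]
      exact splitSum_congr fun I J hIJ => by rw [hz _ J I (by rw [add_comm, hIJ]), mul_zero]
    simp only [h1, h2, zero_add]
    refine Finset.sum_congr rfl fun q _ => ?_
    rw [splitSum_sum]
  · refine (Finset.sum_le_sum fun q hq => ?_).trans (sum_splitSum_ampBound_le ht h K j)
    refine splitSum_mono fun I J hIJ => ?_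
    rw [Finset.HasAntidiagonal.mem_antidiagonal] at hq
    have hc : I.card + J.card = K.card := by rw [← hIJ, Multiset.card_add]
    have hs : I.sum + J.sum = K.sum := by rw [← hIJ, Multiset.sum_add]
    refine sum_antidiagonal_le_of_shift (A := fun μ => G (q.1 + 1) μ I)
      (B := fun ν => G (q.2 + 1) ν J) (x := I.sum + 2) (X := 3 * (q.1 + 1) + I.card)
      (y := J.sum + 2) (Y := 3 * (q.2 + 1) + J.card)
      (fun μ => hG.nonneg hu _ _ _)
      (fun r => ampBound_nonneg ht.le _ _ _) (fun r => ampBound_nonneg ht.le _ _ _)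
      (fun μ hμ => hG.support _ _ _ (by omega)) (fun μ hμ => hG.support _ _ _ (by omega))
      (fun μ r hr => ih _ _ _ (by omega) _ _ rfl (by omega))
      (fun μ r hr => ih _ _ _ (by omega) _ _ rfl (by omega)) (by omega)

theorem tailSum_le_of_le {K : Multiset ℕ} {f : ℕ → Multiset ℕ → ℝ} {W : ℝ}
    (h : ∀ k L, k ::ₘ L = K → f k L ≤ W) :
    tailSum K (fun k L => (2 * (k : ℝ) + 1) * f k L) ≤ (2 * (K.sum : ℝ) + 1 * K.card) * W := by
  rw [← tailSum_const]
  refine tailSum_mono fun k L hL => ?_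
  have := h k L hL
  gcongr

/-- The majorant in positive genus. -/
theorem le_ampBound (hG : IsHeadRecursive u G) (hu : 0 < u) (h i : ℕ) (K : Multiset ℕ) (j : ℕ)
    (hj : i + K.sum + j = 3 * h + 1 + K.card) :
    G (h + 1) i K ≤ ampBound (1 / (6 * u)) h (K.card + 1) j := by
  have ht : 0 < 1 / (6 * u) := by positivity
  have hut : 6 * u * (1 / (6 * u)) = 1 := by field_simp
  set t := 1 / (6 * u)
  have key : ∀ g i K h j, g = h + 1 → i + Multiset.sum K + j + 2 = 3 * g + K.card →
      G g i K ≤ ampBound t h (K.card + 1) j := by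
    intro g i K
    induction g, i, K using amplitude_induction with
    | base g i K h => intros; omega
    | step g i K ih1 ih2 =>
      rintro h j rfl hj
      have hW : 0 ≤ ampBound t h K.card j := ampBound_nonneg ht.le _ _ _
      have small : ∀ i' K', Multiset.card K' + 1 = K.card → i' + K'.sum + j + 1 = 3 * h + 1 + K.card
          → G (h + 1) i' K' ≤ ampBound t h K.card j := fun i' K' h1 h2 => by
        rw [← h1]
        exact ih1 _ i' K' (by omega) h j rfl (by omega)
      have up : ∀ i' K', Multiset.card K' = K.card → i' + K'.sum + j = 3 * h + 2 + K.card →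
          G (h + 1) i' K' ≤ 1 * shiftDown (ampBound t h (K.card + 1)) j := by
        intro i' K' h1 h2
        rcases j with _ | j
        · rw [hG.support _ i' K' (by omega)]
          simp
        · rw [one_mul, ← h1]
          exact ih2 i' K' h1 (by omega) h j rfl (by omega)
      have hjR : (i : ℝ) + K.sum + j = 3 * h + 1 + K.card := by
        have : i + K.sum + j = 3 * h + 1 + K.card := by omega
        exact_mod_cast this
      -- it suffices to remove one index
      have fin : ∀ Y E : ℝ, 0 ≤ E → 6 * u * G (h + 1) i K ≤ 2 * Y + E * ampBound t h K.card j →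
          Y ≤ 1 * shiftDown (ampBound t h (K.card + 1)) j →
          E ≤ 2 * ((i : ℝ) + K.sum) + K.card →
          G (h + 1) i K ≤ ampBound t h (K.card + 1) j := by
        intro Y E hE hX hY hE'
        rw [← one_mul (ampBound t h (K.card + 1) j)]
        refine le_ampBound_of_step (E := E) (Z := 0) ht zero_le_one hut hE
          (by rw [zero_mul, add_zero]; exact hX) hY (one_mul _).ge ?_
        linarith
      by_cases hK0 : 0 ∈ K
      · obtain ⟨L, rfl⟩ := Multiset.exists_cons_of_mem hK0
        simp only [Multiset.sum_cons, zero_add, Multiset.card_cons] at hj hW fin small up ⊢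
        refine fin (G (h + 1) i (1 ::ₘ L)) (2 * (i : ℝ) + 1 + (2 * (L.sum : ℝ) + 1 * L.card))
          (by positivity) ?_ (up _ _ (by simp) (by simp; omega)) (by push_cast; linarith)
        rw [hG.string hu.ne', stringTerm, if_neg (by omega)]
        have h1 : (2 * (i : ℝ) + 1) * shiftDown (fun m => G (h + 1) m L) i ≤
            (2 * (i : ℝ) + 1) * ampBound t h (L.card + 1) j := by
          gcongr
          rcases i with _ | i
          · exact hW
          · exact small i L rfl (by omega)
        have h2 := tailSum_le_of_le (K := L)
          (f := fun k L' => shiftDown (fun m => G (h + 1) i (m ::ₘ L')) k)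
          (W := ampBound t h (L.card + 1) j) (by
            rintro k L' rfl
            simp only [Multiset.sum_cons, Multiset.card_cons] at hj small hW ⊢
            rcases k with _ | k
            · exact hW
            · exact small _ _ (by simp) (by simp; omega))
        linarith
      by_cases hK1 : 1 ∈ K
      · obtain ⟨L, rfl⟩ := Multiset.exists_cons_of_mem hK1
        simp only [Multiset.sum_cons, Multiset.card_cons] at hj hW fin small up ⊢
        refine fin (G (h + 1) i (2 ::ₘ L)) (2 * (i : ℝ) + 1 + (2 * (L.sum : ℝ) + L.card))
          (by positivity) ?_ (up _ _ (by simp) (by simp; omega)) (by push_cast; linarith)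
        rw [hG.dilaton hu.ne']
        have := small i L rfl (by omega)
        gcongr
      have hK2 : ∀ k ∈ K, 2 ≤ k := fun k hk =>
        two_le_of_ne (fun h => hK0 (h ▸ hk)) (fun h => hK1 (h ▸ hk))
      have hY := up (i + 1) K rfl (by omega)
      have hT := tailSum_le_of_le (K := K)
        (f := fun k L => shiftDown (fun m => G (h + 1) m L) (i + k))
        (W := ampBound t h K.card j) (by
          rintro k L rfl
          simp only [Multiset.sum_cons, Multiset.card_cons] at hj small hW ⊢
          rcases hik : i + k with _ | m
          · exact hW
          · exact small _ _ rfl (by omega))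
      have hhead := hG.head (h + 1) i K
      rw [if_neg (by omega)] at hhead
      have hcard := two_mul_card_le_sum hK2
      rcases i with _ | _ | i
      · rw [pairSum_zero, if_neg (by omega)] at hhead
        refine fin _ (2 * (K.sum : ℝ) + 1 * K.card) (by positivity) ?_ hY (by simp)
        linarith
      · by_cases hD : h + 1 = 1 ∧ 0 + 1 = 1 ∧ K = 0
        · obtain ⟨hh, -, rfl⟩ := hD
          obtain rfl : h = 0 := by omega
          obtain rfl : j = 0 := by simp at hj; omega
          simp only [pairSum_one, zero_add, tailSum_zero, true_and, if_true, shiftDown_zero,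
            mul_zero, add_zero, Multiset.card_zero] at hhead hY ⊢
          have : G 1 1 0 = t * (6 * u * G 1 1 0) := by linear_combination -(G 1 1 0) * hut
          have hb : ampBound t 0 1 0 = 3 * t := by simp [ampBound]; ring
          rw [hb, this, hhead]
          nlinarith
        · rw [zero_add, pairSum_one, if_neg hD] at hhead
          refine fin _ (2 * (K.sum : ℝ) + 1 * K.card) (by positivity) ?_ hY (by simp)
          rw [zero_add]
          linarith
      · obtain ⟨h, rfl⟩ : ∃ h', h = h' + 1 := ⟨h - 1, by omega⟩
        have hP := hG.sum_products_le hu ht h i j K hK2 (by omega) (fun g' i' K' hlt =>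
          ih1 g' i' K' (by omega))
        have hLoop : ∑ p ∈ Finset.HasAntidiagonal.antidiagonal i,
            G (h + 1) p.1 (p.2 ::ₘ K) ≤ (i + 1 : ℝ) * ampBound t h (K.card + 2) j := by
          have : ∀ p ∈ Finset.HasAntidiagonal.antidiagonal i, G (h + 1) p.1 (p.2 ::ₘ K) ≤
              ampBound t h (K.card + 2) j := by
            intro p hp
            rw [Finset.HasAntidiagonal.mem_antidiagonal] at hp
            have := ih1 (h + 1) p.1 (p.2 ::ₘ K) (by simp; omega) h j rfl (by simp; omega)
            rwa [Multiset.card_cons] at this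
          refine (Finset.sum_le_card_nsmul _ _ _ this).trans (le_of_eq ?_)
          rw [Finset.Nat.card_antidiagonal, nsmul_eq_mul]
          push_cast
          ring
        rw [pairSum_add_two, if_neg (by omega)] at hhead
        simp only [quadTerm, Finset.sum_add_distrib, Nat.add_eq_zero_iff, one_ne_zero, and_false,
          if_false, Nat.add_sub_cancel] at hhead
        have hV := ampBound_succ_left t h (K.card + 1) j
        have hMpos : (0 : ℝ) < 2 * h + K.card + j + 3 := by positivity
        set V := ampBound t (h + 1) (K.card + 1) j with hVdef
        have hV0 : 0 ≤ V := ampBound_nonneg ht.le _ _ _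
        have hV' : ampBound t h (K.card + 2) j = 4 / 3 / (t * (2 * h + K.card + j + 3)) * V := by
          rw [hV]
          push_cast
          field_simp
          ring
        rw [hV'] at hLoop
        rw [← one_mul V]
        refine le_ampBound_of_step (E := 2 * (K.sum : ℝ) + 1 * K.card)
          (Z := 1 / 2 * ((i + 1) * (4 / 3 / (t * (2 * h + K.card + j + 3))) +
            2 / 3 / (t * (2 * h + 3))))
          ht zero_le_one hut (by positivity) ?_ hY (one_mul _).ge ?_
        · rw [← hVdef, one_mul]
          have hsum : G (h + 1 + 1) = G (h + 2) := rfl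
          linarith
        · have hnj : (K.card : ℝ) + j ≤ 3 * h + 2 := by
            have : K.card + j ≤ 3 * h + 2 := by omega
            exact_mod_cast this
          have e : 3 * (t * (2 * ((h + 1 : ℕ) : ℝ) + K.card + j + 1)) *
              (1 / 2 * ((i + 1) * (4 / 3 / (t * (2 * h + K.card + j + 3))) +
              2 / 3 / (t * (2 * h + 3)))) =
              2 * (i + 1) + (2 * h + K.card + j + 3) / (2 * h + 3) := by
            push_cast
            rw [show (2 * ((h : ℝ) + 1) + K.card + j + 1) = 2 * h + K.card + j + 3 by ring]
            field_simp
            ring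
          rw [e]
          have e2 : (2 * (h : ℝ) + K.card + j + 3) / (2 * h + 3) ≤ 3 := by
            rw [div_le_iff₀ (by positivity)]
            linarith
          push_cast at hjR ⊢
          linarith
  exact key (h + 1) i K h j rfl (by omega)

end IsHeadRecursive

/-- The coefficients of `θ` for the Painlevé I curve, extended by zero to negative indices. -/
noncomputable def piTheta (u : ℝ) (m : ℤ) : ℝ :=
  if m < 0 then 0 else 1 / (6 * u) * (1 / (3 * u)) ^ m.toNat

theorem piTheta_recursion {u : ℝ} (hu : u ≠ 0) (m : ℤ) :
    6 * u * piTheta u m - 2 * piTheta u (m - 1) = if m = 0 then 1 else 0 := by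
  unfold piTheta
  rcases lt_trichotomy m 0 with h | rfl | h
  · rw [if_pos h, if_pos (by omega), if_neg (by omega)]
    simp
  · norm_num
    field_simp
  · rw [if_neg (by omega), if_neg (by omega), if_neg (by omega)]
    obtain ⟨n, rfl⟩ : ∃ n : ℕ, m = n + 1 := ⟨(m - 1).toNat, by omega⟩
    rw [show ((n : ℤ) + 1).toNat = n + 1 by omega, show ((n : ℤ) + 1 - 1).toNat = n by omega,
      pow_succ]
    field_simp
    ring

theorem theta_painleveI {u : ℝ} (hu : u ≠ 0) :
    (painleveI u).theta = HahnSeries.ofPowerSeries ℤ ℝ (PowerSeries.mk fun n =>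
      if Even n then 1 / (6 * u) * (1 / (3 * u)) ^ (n / 2) else 0) *
        HahnSeries.single (-2 : ℤ) (1 : ℝ) := by
  set f : ℝ⟦X⟧ := PowerSeries.mk fun n =>
      if Even n then 1 / (6 * u) * (1 / (3 * u)) ^ (n / 2) else 0 with hf
  have hgeom : f * (1 - PowerSeries.C (1 / (3 * u)) * PowerSeries.X ^ 2) =
      PowerSeries.C (1 / (6 * u)) := by
    ext n
    rw [mul_sub, mul_one, map_sub, mul_left_comm, PowerSeries.coeff_C_mul,
      PowerSeries.coeff_mul_X_pow', PowerSeries.coeff_C, hf, PowerSeries.coeff_mk]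
    rcases n with _ | _ | n
    · simp
    · simp
    · simp only [PowerSeries.coeff_mk, show n + 1 + 1 - 2 = n by omega,
        show (n + 1 + 1) / 2 = n / 2 + 1 by omega, Nat.even_add_one, not_not]
      rw [if_pos (by omega : 2 ≤ n + 1 + 1), if_neg (by omega : ¬n + 1 + 1 = 0)]
      split_ifs
      · ring
      · simp
  have hD : ((painleveI u).y - PowerSeries.evalNegHom (painleveI u).y) *
      PowerSeries.derivative ℝ (painleveI u).x =
      PowerSeries.C (-12 * u) * PowerSeries.X ^ 2 *
        (1 - PowerSeries.C (1 / (3 * u)) * PowerSeries.X ^ 2) := by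
    have h1 : PowerSeries.evalNegHom (painleveI u).y = -(painleveI u).y := by
      ext n
      simp only [painleveI, PowerSeries.evalNegHom, PowerSeries.coeff_rescale, map_sub, map_neg,
        PowerSeries.coeff_C_mul, PowerSeries.coeff_X_pow, PowerSeries.coeff_X]
      rcases eq_or_ne n 3 with rfl | h3
      · norm_num
      rcases eq_or_ne n 1 with rfl | h1
      · norm_num
      simp [h3, h1]
    have h2 : PowerSeries.derivative ℝ (painleveI u).x = 2 * PowerSeries.X := by
      simp [OnePointCurve.x, PowerSeries.derivative_C, PowerSeries.derivative_X]
    have h3 : (PowerSeries.C (-12 * u) : ℝ⟦X⟧) = -4 * PowerSeries.C (3 * u) := by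
      rw [show -12 * u = -(4 * (3 * u)) by ring, map_neg, map_mul, map_ofNat, neg_mul]
    have h4 : (PowerSeries.C (3 * u) : ℝ⟦X⟧) * PowerSeries.C (1 / (3 * u)) = 1 := by
      rw [← map_mul, mul_one_div_cancel (by simpa using hu), map_one]
    rw [h1, h2, h3, painleveI]
    linear_combination (-4 * PowerSeries.X ^ 4) * h4
  have hne : ((((painleveI u).y - PowerSeries.evalNegHom (painleveI u).y) *
      PowerSeries.derivative ℝ (painleveI u).x : ℝ⟦X⟧) : ℝ⸨X⸩) ≠ 0 := by
    rw [hD]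
    intro h0
    have h0' : (PowerSeries.C (-12 * u) * PowerSeries.X ^ 2 *
        (1 - PowerSeries.C (1 / (3 * u)) * PowerSeries.X ^ 2) : ℝ⟦X⟧) = 0 :=
      HahnSeries.ofPowerSeries_injective (Γ := ℤ) (by simpa using h0)
    have := congrArg (PowerSeries.coeff 2) h0'
    rw [mul_assoc, PowerSeries.coeff_C_mul, PowerSeries.coeff_X_pow_mul'] at this
    simp [hu] at this
  rw [OnePointCurve.theta, div_eq_iff hne, hD]
  have e1 : HahnSeries.single (-2 : ℤ) (1 : ℝ) *
      HahnSeries.ofPowerSeries ℤ ℝ (PowerSeries.X ^ 2) = 1 := by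
    rw [HahnSeries.ofPowerSeries_X_pow, HahnSeries.single_mul_single]
    simp
  have e2 := congrArg (HahnSeries.ofPowerSeries ℤ ℝ) hgeom
  rw [map_mul] at e2
  have e3 : HahnSeries.ofPowerSeries ℤ ℝ (PowerSeries.C (-12 * u)) *
      HahnSeries.ofPowerSeries ℤ ℝ (PowerSeries.C (1 / (6 * u))) = -2 := by
    rw [← map_mul, ← map_mul, show -12 * u * (1 / (6 * u)) = -2 by field_simp; norm_num, map_neg,
      map_neg, map_ofNat, map_ofNat]
  rw [map_mul, map_mul]
  calc (-2 : ℝ⸨X⸩) = HahnSeries.ofPowerSeries ℤ ℝ (PowerSeries.C (-12 * u)) *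
        (HahnSeries.ofPowerSeries ℤ ℝ (PowerSeries.C (1 / (6 * u)))) := e3.symm
    _ = _ := by
      rw [← e2]
      linear_combination (-(HahnSeries.ofPowerSeries ℤ ℝ (PowerSeries.C (-12 * u)) *
        HahnSeries.ofPowerSeries ℤ ℝ f *
        HahnSeries.ofPowerSeries ℤ ℝ
          (1 - PowerSeries.C (1 / (3 * u)) * PowerSeries.X ^ 2))) * e1

theorem theta_painleveI_coeff {u : ℝ} (hu : u ≠ 0) (m : ℤ) :
    (painleveI u).theta.coeff (2 * m - 2) = piTheta u m := by
  rw [theta_painleveI hu, HahnSeries.coeff_mul_single, mul_one,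
    show 2 * m - 2 - -2 = 2 * m by ring, PowerSeries.coeff_coe, piTheta]
  rcases lt_or_ge m 0 with h | h
  · rw [if_pos h, if_pos (by omega)]
  · rw [if_neg (by omega), if_neg (by omega), PowerSeries.coeff_mk,
      show (2 * m).natAbs = 2 * m.toNat by omega, if_pos (even_two_mul _),
      Nat.mul_div_cancel_left _ two_pos]

theorem ofPowerSeries_monomial (n : ℕ) (c : ℝ) :
    HahnSeries.ofPowerSeries ℤ ℝ (PowerSeries.monomial n c) = HahnSeries.single (n : ℤ) c := by
  ext z
  rw [PowerSeries.coeff_coe, HahnSeries.coeff_single]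
  split_ifs with h1 h2 h2
  · omega
  · rfl
  · rw [PowerSeries.coeff_monomial, if_pos (by omega)]
  · rw [PowerSeries.coeff_monomial, if_neg (by omega)]

theorem xi_painleveI (u : ℝ) (i : ℕ) :
    (painleveI u).xi i = HahnSeries.single (-(2 * (i : ℤ) + 2)) (((2 * i + 1)‼ : ℕ) : ℝ) := by
  have ha : (HahnSeries.single (1 : ℤ) (1 : ℝ)) ≠ 0 := HahnSeries.single_ne_zero one_ne_zero
  set a : ℝ⸨X⸩ := HahnSeries.single (1 : ℤ) (1 : ℝ) with hadef
  have hcast : ∀ n : ℕ, (n : ℝ⸨X⸩) = HahnSeries.single (0 : ℤ) (n : ℝ) := fun n => by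
    rw [← HahnSeries.C_apply, map_natCast]
  have hinv : ((PowerSeries.C a - PowerSeries.X) ^ 2)⁻¹ =
      (PowerSeries.mk fun n => a⁻¹ ^ (n + 1)) ^ 2 := by
    have h1 : (PowerSeries.mk fun n => a⁻¹ ^ (n + 1)) * (PowerSeries.C a - PowerSeries.X) = 1 := by
      ext1 n
      rw [mul_sub, map_sub, PowerSeries.coeff_mul_C, PowerSeries.coeff_mk]
      rcases n with _ | n
      · simp [ha]
      · rw [PowerSeries.coeff_succ_mul_X, PowerSeries.coeff_mk, PowerSeries.coeff_one,
          if_neg (by omega), pow_succ _ (n + 1), mul_assoc, inv_mul_cancel₀ ha, mul_one, sub_self]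
    rw [PowerSeries.inv_eq_iff_mul_eq_one (by simp [ha]), ← mul_pow, h1, one_pow]
  have hω : (painleveI u).omega02 = (PowerSeries.mk fun n => a⁻¹ ^ (n + 1)) ^ 2 := by
    rw [OnePointCurve.omega02, hinv]
    refine add_eq_left.mpr ?_
    ext1 n
    rw [PowerSeries.coeff_mk]
    have : (PowerSeries.mk fun m₁ => (painleveI u).b m₁ n : ℝ⟦X⟧) = 0 := by
      ext m
      simp [painleveI]
    rw [this]
    simp
  have hcoeff : PowerSeries.coeff (2 * i) ((painleveI u).omega02) =
      ((2 * i + 1 : ℕ) : ℝ⸨X⸩) * a⁻¹ ^ (2 * i + 2) := by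
    rw [hω, sq, PowerSeries.coeff_mul]
    rw [Finset.sum_congr rfl (g := fun _ => a⁻¹ ^ (2 * i + 2))]
    · rw [Finset.sum_const, Finset.Nat.card_antidiagonal, nsmul_eq_mul]
    · intro p hp
      rw [Finset.HasAntidiagonal.mem_antidiagonal] at hp
      rw [PowerSeries.coeff_mk, PowerSeries.coeff_mk, ← pow_add, ← hp]
      congr 1
      ring
  have hne : ((2 * i + 1 : ℕ) : ℝ⸨X⸩) ≠ 0 := by
    rw [hcast]
    exact HahnSeries.single_ne_zero (by positivity)
  have hinva : a⁻¹ = HahnSeries.single (-1 : ℤ) (1 : ℝ) := by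
    rw [hadef, HahnSeries.inv_single, inv_one]
  rw [OnePointCurve.xi, primitive, PowerSeries.coeff_mk, if_neg (by omega), Nat.add_sub_cancel,
    hcoeff, mul_div_cancel_left₀ _ hne, hinva, HahnSeries.single_pow, hcast,
    HahnSeries.single_mul_single]
  simp

theorem coe_e (i : ℕ) : ((OnePointCurve.e ℝ i : ℝ⟦X⟧) : ℝ⸨X⸩) =
    HahnSeries.single (2 * (i : ℤ) + 1) (1 / (((2 * i + 1)‼ : ℕ) : ℝ)) := by
  rw [OnePointCurve.e, ofPowerSeries_monomial]
  push_cast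
  rfl

theorem coe_de (i : ℕ) : ((OnePointCurve.de ℝ i : ℝ⟦X⟧) : ℝ⸨X⸩) =
    HahnSeries.single (2 * (i : ℤ)) ((2 * (i : ℝ) + 1) / (((2 * i + 1)‼ : ℕ) : ℝ)) := by
  have : OnePointCurve.de ℝ i =
      PowerSeries.monomial (2 * i) ((2 * (i : ℝ) + 1) / (((2 * i + 1)‼ : ℕ) : ℝ)) := by
    ext n
    rw [OnePointCurve.de, OnePointCurve.e, PowerSeries.coeff_derivative, PowerSeries.coeff_monomial,
      PowerSeries.coeff_monomial]
    by_cases h : n = 2 * i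
    · rw [if_pos (by omega), if_pos h, h]
      push_cast
      ring
    · rw [if_neg (by omega), if_neg h, zero_mul]
  rw [this, ofPowerSeries_monomial]
  push_cast
  rfl

theorem airy_A {u : ℝ} (hu : u ≠ 0) (i j k : ℕ) : (painleveI u).airy.A i j k =
    if i = 0 ∧ j = 0 ∧ k = 0 then 1 / (6 * u) else 0 := by
  simp only [OnePointCurve.airy, residue, coe_e, coe_de, HahnSeries.coeff_mul_single]
  rw [show (-1 - 2 * (k : ℤ) - 2 * j - (2 * i + 1)) = 2 * (-(i + j + k : ℤ)) - 2 by ring,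
    theta_painleveI_coeff hu, piTheta]
  by_cases h : i = 0 ∧ j = 0 ∧ k = 0
  · obtain ⟨rfl, rfl, rfl⟩ := h
    simp
  · rw [if_neg h, if_pos (by omega)]
    ring

theorem airy_B {u : ℝ} (hu : u ≠ 0) (i j k : ℕ) : (painleveI u).airy.B i j k =
    piTheta u ((k : ℤ) + 1 - i - j) * (1 / (((2 * i + 1)‼ : ℕ) : ℝ)) *
      ((2 * (j : ℝ) + 1) / (((2 * j + 1)‼ : ℕ) : ℝ)) * (((2 * k + 1)‼ : ℕ) : ℝ) := by
  simp only [OnePointCurve.airy, residue, coe_e, coe_de, xi_painleveI, HahnSeries.coeff_mul_single]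
  rw [← theta_painleveI_coeff hu]
  ring_nf

theorem airy_C {u : ℝ} (hu : u ≠ 0) (i j k : ℕ) : (painleveI u).airy.C i j k =
    piTheta u ((j : ℤ) + k + 2 - i) * (1 / (((2 * i + 1)‼ : ℕ) : ℝ)) *
      (((2 * j + 1)‼ : ℕ) : ℝ) * (((2 * k + 1)‼ : ℕ) : ℝ) := by
  simp only [OnePointCurve.airy, residue, coe_e, xi_painleveI, HahnSeries.coeff_mul_single]
  rw [← theta_painleveI_coeff hu]
  ring_nf

theorem airy_D {u : ℝ} (hu : u ≠ 0) (i : ℕ) : (painleveI u).airy.D i * (((2 * i + 1)‼ : ℕ) : ℝ) =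
    piTheta u (1 - i) / 8 := by
  have h0 : (painleveI u).thetaCoeff 0 = piTheta u 0 := by
    rw [OnePointCurve.thetaCoeff, ← theta_painleveI_coeff hu]
    rfl
  have h1 : (painleveI u).thetaCoeff 1 = piTheta u 1 := by
    rw [OnePointCurve.thetaCoeff, ← theta_painleveI_coeff hu]
    rfl
  have h2 : (painleveI u).phi 0 0 = 0 := rfl
  simp only [OnePointCurve.airy, h0, h1, h2, mul_zero, zero_add]
  match i with
  | 0 => simp
  | 1 =>
    norm_num [Nat.doubleFactorial]
    ring
  | i + 2 =>
    rw [if_neg (by omega), if_neg (by omega), piTheta, if_pos (by push_cast; omega)]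
    simp

theorem sum_get_eraseIdx (l : List ℕ) (f : ℕ → List ℕ → ℝ) (F : ℕ → Multiset ℕ → ℝ)
    (h : ∀ k L, L.length + 1 = l.length → f k L = F k L) :
    ∑ m : Fin l.length, f (l.get m) (l.eraseIdx m) = tailSum l F := by
  induction l generalizing f F with
  | nil => simp
  | cons a l ih =>
    rw [← Multiset.cons_coe, tailSum_cons]
    simp only [List.length_cons]
    rw [Fin.sum_univ_succ]
    congr 1
    · exact h _ _ rfl
    · refine ih (fun k L => f k (a :: L)) _ fun k L hL => ?_
      rw [h k (a :: L) (by simp [hL]), Multiset.cons_coe]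

theorem coe_listSplits (l : List ℕ) :
    (((listSplits l).map fun s => ((s.1 : Multiset ℕ), (s.2 : Multiset ℕ)) : List _) :
      Multiset (Multiset ℕ × Multiset ℕ)) = Multiset.antidiagonal l := by
  induction l with
  | nil => simp [listSplits]
  | cons a l ih =>
    rw [← Multiset.cons_coe, Multiset.antidiagonal_cons, ← ih, listSplits, List.map_append,
      List.map_map, List.map_map, Multiset.map_coe, Multiset.map_coe, List.map_map, List.map_map,
      Multiset.coe_add, Multiset.coe_eq_coe]
    exact List.perm_append_comm

theorem sum_listSplits (l : List ℕ) (f : List ℕ → List ℕ → ℝ)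
    (F : Multiset ℕ → Multiset ℕ → ℝ)
    (h : ∀ I J, I.length + J.length = l.length → f I J = F I J) :
    ((listSplits l).map fun s => f s.1 s.2).sum = splitSum l F := by
  rw [splitSum, ← coe_listSplits, Multiset.map_coe, List.map_map, Multiset.sum_coe]
  congr 1
  exact List.map_congr_left fun s hs => h _ _ (length_of_mem_listSplits hs)

namespace AiryTensors

/-- The amplitude as a function of its first index and the multiset of the others. -/
noncomputable def headAmplitude (Q : AiryTensors ℝ) (g i : ℕ) (K : Multiset ℕ) : ℝ :=
  Q.amplitude g (i :: K.toList)

theorem headAmplitude_eq_zero_of_unstable (Q : AiryTensors ℝ) (g i : ℕ) (K : Multiset ℕ)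
    (h : 2 * g + K.card ≤ 1) : Q.headAmplitude g i K = 0 :=
  Q.amplitude_eq_zero_of_unstable _ _ (by simp; omega)

/-- The right-hand side of the recursion, in terms of multisets. -/
noncomputable def recursionTerm (Q : AiryTensors ℝ) (g i : ℕ) (K : Multiset ℕ) : ℝ :=
  tailSum K (fun k L => ∑ᶠ μ : ℕ, Q.B i k μ * Q.headAmplitude g μ L) +
    1 / 2 * ∑ᶠ p : ℕ × ℕ, Q.C i p.1 p.2 * quadTerm Q.headAmplitude g p.1 p.2 K

theorem amplitude_eq_recursionTerm (Q : AiryTensors ℝ) (g i : ℕ) (l : List ℕ)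
    (h : 2 < 2 * g + (i :: l).length) (h03 : ¬(g = 0 ∧ l.length = 2))
    (h11 : ¬(g = 1 ∧ l.length = 0))
    (ih : ∀ g' i' l', 2 * g' + List.length l' < 2 * g + l.length →
      Q.amplitude g' (i' :: l') = Q.headAmplitude g' i' l') :
    Q.amplitude g (i :: l) = Q.recursionTerm g i l := by
  rw [amplitude_rec Q g i l h h03 h11, recursionTerm]
  congr 1
  · refine sum_get_eraseIdx l (fun k L => ∑ᶠ μ : ℕ, Q.B i k μ * Q.amplitude g (μ :: L)) _
      fun k L hL => finsum_congr fun μ => ?_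
    rw [ih _ _ _ (by omega)]
  · congr 1
    refine finsum_congr fun p => ?_
    rw [quadTerm]
    congr 2
    · by_cases hg : g = 0
      · simp [hg]
      · rw [if_neg hg, if_pos (by omega), ih _ _ _ (by simp; omega), Multiset.cons_coe]
    · refine Finset.sum_congr rfl fun q hq => ?_
      rw [Finset.HasAntidiagonal.mem_antidiagonal] at hq
      refine sum_listSplits l (fun I J => Q.amplitude q.1 (p.1 :: I) * Q.amplitude q.2 (p.2 :: J)) _
        fun I J hIJ => ?_
      by_cases hI : 2 * q.1 + I.length < 2 * g + l.length
      · by_cases hJ : 2 * q.2 + J.length < 2 * g + l.length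
        · rw [ih _ _ _ hI, ih _ _ _ hJ]
        · rw [amplitude_eq_zero_of_unstable Q q.1 _ (by simp; omega),
            headAmplitude_eq_zero_of_unstable Q q.1 _ _ (by simp; omega), zero_mul, zero_mul]
      · rw [amplitude_eq_zero_of_unstable Q q.2 _ (by simp; omega),
          headAmplitude_eq_zero_of_unstable Q q.2 _ _ (by simp; omega), mul_zero, mul_zero]

theorem amplitude_eq_headAmplitude (Q : AiryTensors ℝ) (hA : ∀ i j k, Q.A i j k = Q.A i k j)
    (g i : ℕ) (l : List ℕ) : Q.amplitude g (i :: l) = Q.headAmplitude g i l := by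
  induction hN : 2 * g + l.length using Nat.strong_induction_on generalizing g i l with
  | _ N ih =>
    have hperm : (l : Multiset ℕ).toList.Perm l := Multiset.coe_eq_coe.mp (by simp)
    have hlen : (l : Multiset ℕ).toList.length = l.length := by simp
    by_cases hst : 2 < 2 * g + (i :: l).length
    · by_cases h03 : g = 0 ∧ l.length = 2
      · obtain ⟨rfl, h2⟩ := h03
        obtain ⟨j, k, rfl⟩ := List.length_eq_two.mp h2
        obtain ⟨a, b, hab⟩ := List.length_eq_two.mp (hlen.trans h2)
        rw [headAmplitude, hab]
        rw [hab] at hperm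
        simp only [amplitude]
        have hm := Multiset.coe_eq_coe.mpr hperm
        simp only [← Multiset.cons_coe, Multiset.coe_nil, Multiset.cons_zero] at hm
        rcases Multiset.cons_eq_cons.mp hm with ⟨rfl, h⟩ | ⟨-, cs, h1, h2⟩
        · rw [Multiset.singleton_inj.mp h]
        · have hcs : cs = 0 := by
            have := congrArg Multiset.card h1
            simp at this
            exact this
          subst hcs
          simp only [Multiset.cons_zero, Multiset.singleton_inj] at h1 h2
          rw [h1, ← h2, hA]
      · by_cases h11 : g = 1 ∧ l.length = 0
        · obtain ⟨rfl, h0⟩ := h11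
          obtain rfl := List.length_eq_zero_iff.mp h0
          simp [headAmplitude]
        · have ih' : ∀ g' i' l', 2 * g' + List.length l' < 2 * g + l.length →
              Q.amplitude g' (i' :: l') = Q.headAmplitude g' i' l' :=
            fun g' i' l' hlt => ih _ (by omega) g' i' l' rfl
          rw [headAmplitude, amplitude_eq_recursionTerm Q g i l hst h03 h11 ih',
            amplitude_eq_recursionTerm Q g i (l : Multiset ℕ).toList (by simpa using hst)
              (by rw [hlen]; exact h03) (by rw [hlen]; exact h11) (by rw [hlen]; exact ih'),
            Multiset.coe_toList]
    · rw [amplitude_eq_zero_of_unstable Q g _ (by omega),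
        headAmplitude_eq_zero_of_unstable Q g _ _ (by simp at hst ⊢; omega)]

theorem headAmplitude_eq_recursionTerm (Q : AiryTensors ℝ)
    (hA : ∀ i j k, Q.A i j k = Q.A i k j) (g i : ℕ) (K : Multiset ℕ)
    (h : 1 < 2 * g + K.card) (h03 : ¬(g = 0 ∧ K.card = 2)) (h11 : ¬(g = 1 ∧ K.card = 0)) :
    Q.headAmplitude g i K = Q.recursionTerm g i K := by
  conv_rhs => rw [← Multiset.coe_toList K]
  exact Q.amplitude_eq_recursionTerm g i K.toList (by simp; omega) (by simpa using h03)
    (by simpa using h11) fun g' i' l' _ => Q.amplitude_eq_headAmplitude hA g' i' l'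

end AiryTensors

/-- The weight `(2k+1)!!`. -/
noncomputable def dfWeight (k : ℕ) : ℝ := ((2 * k + 1)‼ : ℕ)

theorem dfWeight_pos (k : ℕ) : 0 < dfWeight k := by
  unfold dfWeight
  exact_mod_cast Nat.doubleFactorial_pos _

/-- The amplitudes of the Painlevé I curve multiplied by `(2k+1)!!` for each index `k`. -/
noncomputable def normAmp (u : ℝ) (g i : ℕ) (K : Multiset ℕ) : ℝ :=
  (painleveI u).airy.headAmplitude g i K * (dfWeight i * (K.map dfWeight).prod)

theorem quadTerm_normAmp (u : ℝ) (g μ ν : ℕ) (K : Multiset ℕ) :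
    quadTerm (normAmp u) g μ ν K = dfWeight μ * dfWeight ν * (K.map dfWeight).prod *
      quadTerm (painleveI u).airy.headAmplitude g μ ν K := by
  rw [quadTerm, quadTerm, mul_add, Finset.mul_sum]
  congr 1
  · split_ifs
    · simp
    · rw [normAmp, Multiset.map_cons, Multiset.prod_cons]
      ring
  · refine Finset.sum_congr rfl fun q _ => ?_
    rw [← splitSum_mul_left]
    refine splitSum_congr fun I J hIJ => ?_
    rw [normAmp, normAmp, ← hIJ, Multiset.map_add, Multiset.prod_add]
    ring

theorem airy_A_comm {u : ℝ} (hu : u ≠ 0) (i j k : ℕ) :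
    (painleveI u).airy.A i j k = (painleveI u).airy.A i k j := by
  rw [airy_A hu, airy_A hu]
  simp only [and_comm (a := j = 0)]

theorem normAmp_rec {u : ℝ} (hu : u ≠ 0) (g i : ℕ) (K : Multiset ℕ)
    (h : 1 < 2 * g + K.card) (h03 : ¬(g = 0 ∧ K.card = 2)) (h11 : ¬(g = 1 ∧ K.card = 0)) :
    normAmp u g i K = tailSum K (fun k L => (2 * (k : ℝ) + 1) *
        ∑ᶠ μ : ℕ, piTheta u ((μ : ℤ) + 1 - (i + k : ℕ)) * normAmp u g μ L) +
      1 / 2 * ∑ᶠ p : ℕ × ℕ, piTheta u ((p.1 : ℤ) + p.2 + 2 - i) *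
        quadTerm (normAmp u) g p.1 p.2 K := by
  have hw := fun k => (dfWeight_pos k).ne'
  rw [normAmp, (painleveI u).airy.headAmplitude_eq_recursionTerm (airy_A_comm hu) g i K h h03 h11,
    AiryTensors.recursionTerm, add_mul]
  congr 1
  · rw [← tailSum_mul_right]
    refine tailSum_congr fun k L hL => ?_
    rw [mul_comm, ← smul_eq_mul, smul_finsum, ← smul_eq_mul (a := 2 * (k : ℝ) + 1), smul_finsum]
    refine finsum_congr fun μ => ?_
    have hp : (K.map dfWeight).prod = dfWeight k * (L.map dfWeight).prod := by
      rw [← hL, Multiset.map_cons, Multiset.prod_cons]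
    rw [smul_eq_mul, smul_eq_mul, hp, normAmp, airy_B hu]
    rw [show ((μ : ℤ) + 1 - (i + k : ℕ)) = (μ : ℤ) + 1 - i - k by push_cast; ring]
    change dfWeight i * (dfWeight k * _) * (piTheta u _ * (1 / dfWeight i) *
      ((2 * (k : ℝ) + 1) / dfWeight k) * dfWeight μ * _) = _
    have h1 := hw i
    have h2 := hw k
    field_simp
  · rw [mul_assoc]
    congr 1
    rw [mul_comm, ← smul_eq_mul, smul_finsum]
    refine finsum_congr fun p => ?_
    rw [smul_eq_mul, quadTerm_normAmp, airy_C hu]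
    change dfWeight i * _ * (piTheta u _ * (1 / dfWeight i) * dfWeight p.1 * dfWeight p.2 * _) = _
    have h1 := hw i
    field_simp

theorem normAmp_unstable (u : ℝ) (g i : ℕ) (K : Multiset ℕ) (h : 2 * g + K.card ≤ 1) :
    normAmp u g i K = 0 := by
  rw [normAmp, AiryTensors.headAmplitude_eq_zero_of_unstable _ _ _ _ h, zero_mul]

theorem normAmp_three {u : ℝ} (hu : u ≠ 0) (i j k : ℕ) :
    normAmp u 0 i {j, k} = if i = 0 ∧ j = 0 ∧ k = 0 then 1 / (6 * u) else 0 := by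
  have h := (painleveI u).airy.amplitude_eq_headAmplitude (airy_A_comm hu) 0 i [j, k]
  rw [show (([j, k] : List ℕ) : Multiset ℕ) = {j, k} from rfl] at h
  rw [normAmp, ← h, AiryTensors.amplitude, airy_A hu]
  split_ifs with hz
  · obtain ⟨rfl, rfl, rfl⟩ := hz
    simp [dfWeight]
  · simp

theorem normAmp_torus {u : ℝ} (hu : u ≠ 0) (i : ℕ) :
    normAmp u 1 i 0 = piTheta u (1 - i) / 8 := by
  rw [← airy_D hu, normAmp, AiryTensors.headAmplitude, Multiset.toList_zero, AiryTensors.amplitude]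
  simp [dfWeight]

theorem quadTerm_eq_zero {G : ℕ → ℕ → Multiset ℕ → ℝ} {g μ ν : ℕ} {K : Multiset ℕ}
    (h1 : g ≠ 0 → G (g - 1) μ (ν ::ₘ K) = 0)
    (h2 : ∀ a b I J, a + b = g → I + J = K → G a μ I = 0 ∨ G b ν J = 0) :
    quadTerm G g μ ν K = 0 := by
  rw [quadTerm, Finset.sum_eq_zero, add_zero]
  · split_ifs with hg
    · rfl
    · exact h1 hg
  · intro q hq
    rw [← splitSum_const_zero K]
    refine splitSum_congr fun I J hIJ => mul_eq_zero.mpr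
      (h2 _ _ I J (Finset.HasAntidiagonal.mem_antidiagonal.mp hq) hIJ)

theorem piTheta_of_neg (u : ℝ) {m : ℤ} (h : m < 0) : piTheta u m = 0 := if_pos h

theorem normAmp_support {u : ℝ} (hu : u ≠ 0) (g i : ℕ) (K : Multiset ℕ)
    (h : 3 * g + K.card < i + K.sum + 2) : normAmp u g i K = 0 := by
  induction hN : 2 * g + K.card using Nat.strong_induction_on generalizing g i K with
  | _ N ih =>
    subst hN
    by_cases hst : 2 * g + K.card ≤ 1
    · exact normAmp_unstable u g i K hst
    by_cases h03 : g = 0 ∧ K.card = 2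
    · obtain ⟨rfl, h2⟩ := h03
      obtain ⟨j, k, rfl⟩ := Multiset.card_eq_two.mp h2
      rw [normAmp_three hu, if_neg]
      rintro ⟨rfl, rfl, rfl⟩
      simp at h
    by_cases h11 : g = 1 ∧ K.card = 0
    · obtain ⟨rfl, h0⟩ := h11
      obtain rfl := Multiset.card_eq_zero.mp h0
      rw [normAmp_torus hu, piTheta_of_neg, zero_div]
      simp at h
      omega
    rw [normAmp_rec hu g i K (by omega) h03 h11]
    have hT : tailSum K (fun k L => (2 * (k : ℝ) + 1) *
        ∑ᶠ μ : ℕ, piTheta u ((μ : ℤ) + 1 - (i + k : ℕ)) * normAmp u g μ L) = 0 := by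
      rw [← tailSum_const_zero K]
      refine tailSum_congr fun k L hL => ?_
      rw [finsum_eq_zero_of_forall_eq_zero, mul_zero]
      intro μ
      subst hL
      simp only [Multiset.card_cons, Multiset.sum_cons] at h ih
      by_cases hμ : μ + 1 < i + k
      · rw [piTheta_of_neg u (by push_cast; omega), zero_mul]
      · rw [ih _ (by omega) g μ L (by omega) rfl, mul_zero]
    rw [hT, finsum_eq_zero_of_forall_eq_zero]
    · ring
    · intro p
      by_cases hp : p.1 + p.2 + 2 < i
      · rw [piTheta_of_neg u (by omega), zero_mul]
      · rw [quadTerm_eq_zero, mul_zero]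
        · intro hg
          exact ih _ (by simp; omega) _ _ _ (by simp; omega) rfl
        · intro a b I J hab hIJ
          have hc : I.card + J.card = K.card := by rw [← hIJ, Multiset.card_add]
          have hs : I.sum + J.sum = K.sum := by rw [← hIJ, Multiset.sum_add]
          by_cases hI1 : 2 * a + I.card ≤ 1
          · exact Or.inl (normAmp_unstable u _ _ _ hI1)
          by_cases hJ1 : 2 * b + J.card ≤ 1
          · exact Or.inr (normAmp_unstable u _ _ _ hJ1)
          by_cases hI : 3 * a + I.card < p.1 + I.sum + 2
          · exact Or.inl (ih _ (by omega) a p.1 I hI rfl)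
          · exact Or.inr (ih _ (by omega) b p.2 J (by omega) rfl)

theorem finsum_piTheta {α : Type*} {u : ℝ} (hu : u ≠ 0) (e : α → ℤ) (f : α → ℝ)
    (hf : f.support.Finite) :
    6 * u * ∑ᶠ a, piTheta u (e a) * f a - 2 * ∑ᶠ a, piTheta u (e a - 1) * f a =
      ∑ᶠ a, if e a = 0 then f a else 0 := by
  have h1 : (Function.support fun a => 6 * u * (piTheta u (e a) * f a)).Finite :=
    hf.subset fun a ha hfa => ha (by simp [hfa])
  have h2 : (Function.support fun a => 2 * (piTheta u (e a - 1) * f a)).Finite :=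
    hf.subset fun a ha hfa => ha (by simp [hfa])
  rw [← smul_eq_mul (a := 6 * u), ← smul_eq_mul (a := (2 : ℝ)), smul_finsum, smul_finsum]
  simp only [smul_eq_mul]
  rw [← finsum_sub_distrib h1 h2]
  refine finsum_congr fun a => ?_
  have := piTheta_recursion hu (e a)
  rw [show 6 * u * (piTheta u (e a) * f a) - 2 * (piTheta u (e a - 1) * f a) =
    (6 * u * piTheta u (e a) - 2 * piTheta u (e a - 1)) * f a by ring, this]
  split_ifs <;> simp

theorem finsum_piTheta_single {u : ℝ} (hu : u ≠ 0) (s : ℕ) (f : ℕ → ℝ) (hf : f.support.Finite) :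
    6 * u * ∑ᶠ μ : ℕ, piTheta u ((μ : ℤ) + 1 - s) * f μ -
      2 * ∑ᶠ μ : ℕ, piTheta u ((μ : ℤ) + 1 - (s + 1 : ℕ)) * f μ = shiftDown f s := by
  have h := finsum_piTheta hu (fun μ : ℕ => (μ : ℤ) + 1 - s) f hf
  simp only [show ∀ μ : ℕ, (μ : ℤ) + 1 - s - 1 = (μ : ℤ) + 1 - (s + 1 : ℕ) by
    intro μ; push_cast; ring] at h
  rw [h]
  rcases s with _ | s
  · rw [finsum_eq_zero_of_forall_eq_zero, shiftDown_zero]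
    intro μ
    rw [if_neg]
    push_cast
    omega
  · rw [finsum_eq_single _ s, if_pos (by push_cast; ring), shiftDown_succ]
    intro μ hμ
    rw [if_neg]
    push_cast
    omega

theorem finsum_piTheta_pair {u : ℝ} (hu : u ≠ 0) (i : ℕ) (f : ℕ → ℕ → ℝ)
    (hf : (Function.support fun p : ℕ × ℕ => f p.1 p.2).Finite) :
    6 * u * ∑ᶠ p : ℕ × ℕ, piTheta u ((p.1 : ℤ) + p.2 + 2 - i) * f p.1 p.2 -
      2 * ∑ᶠ p : ℕ × ℕ, piTheta u ((p.1 : ℤ) + p.2 + 2 - (i + 1 : ℕ)) * f p.1 p.2 =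
      pairSum f i := by
  have h := finsum_piTheta hu (fun p : ℕ × ℕ => (p.1 : ℤ) + p.2 + 2 - i)
    (fun p : ℕ × ℕ => f p.1 p.2) hf
  simp only [show ∀ p : ℕ × ℕ, (p.1 : ℤ) + p.2 + 2 - i - 1 = (p.1 : ℤ) + p.2 + 2 - (i + 1 : ℕ) by
    intro p; push_cast; ring] at h
  rw [h]
  have hz : i < 2 → ∑ᶠ p : ℕ × ℕ, (if (p.1 : ℤ) + p.2 + 2 - i = 0 then f p.1 p.2 else 0) = 0 :=
    fun hi => finsum_eq_zero_of_forall_eq_zero fun p => if_neg (by omega)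
  match i with
  | 0 => exact hz (by norm_num)
  | 1 => exact hz (by norm_num)
  | i + 2 =>
    rw [pairSum_add_two,
      finsum_eq_sum_of_support_subset (s := Finset.HasAntidiagonal.antidiagonal i)]
    · refine Finset.sum_congr rfl fun p hp => if_pos ?_
      rw [Finset.HasAntidiagonal.mem_antidiagonal] at hp
      push_cast
      omega
    · intro p hp
      rw [Finset.mem_coe, Finset.HasAntidiagonal.mem_antidiagonal]
      by_contra hne
      refine hp (if_neg ?_)
      push_cast
      omega

theorem pairSum_eq_zero {f : ℕ → ℕ → ℝ} (h : ∀ μ ν, f μ ν = 0) (i : ℕ) : pairSum f i = 0 := by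
  match i with
  | 0 => rfl
  | 1 => rfl
  | i + 2 => exact Finset.sum_eq_zero fun p _ => h _ _

theorem normAmp_head_of_stable {u : ℝ} (hu : u ≠ 0) (g i : ℕ) (K : Multiset ℕ)
    (h : 1 < 2 * g + K.card) (h03 : ¬(g = 0 ∧ K.card = 2)) (h11 : ¬(g = 1 ∧ K.card = 0)) :
    6 * u * normAmp u g i K = 2 * normAmp u g (i + 1) K +
      tailSum K (fun k L => (2 * (k : ℝ) + 1) * shiftDown (fun m => normAmp u g m L) (i + k)) +
      1 / 2 * pairSum (fun μ ν => quadTerm (normAmp u) g μ ν K) i := by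
  have hsupp : (Function.support fun p : ℕ × ℕ => quadTerm (normAmp u) g p.1 p.2 K).Finite := by
    refine (Finset.finite_toSet
      (Finset.range (3 * g + K.card) ×ˢ Finset.range (3 * g + K.card))).subset fun p hp => ?_
    by_contra hne
    refine hp (quadTerm_eq_zero (fun hg => normAmp_support hu _ _ _ ?_) fun a b I J hab hIJ => ?_)
    · simp at hne ⊢
      omega
    · have hc : I.card + J.card = K.card := by rw [← hIJ, Multiset.card_add]
      by_cases hI : 3 * a + I.card < p.1 + I.sum + 2
      · exact Or.inl (normAmp_support hu _ _ _ hI)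
      · refine Or.inr (normAmp_support hu _ _ _ ?_)
        simp at hne
        omega
  have hP := finsum_piTheta_pair hu i (fun μ ν => quadTerm (normAmp u) g μ ν K) hsupp
  have hT : 6 * u * tailSum K (fun k L => (2 * (k : ℝ) + 1) *
        ∑ᶠ μ : ℕ, piTheta u ((μ : ℤ) + 1 - (i + k : ℕ)) * normAmp u g μ L) =
      2 * tailSum K (fun k L => (2 * (k : ℝ) + 1) *
        ∑ᶠ μ : ℕ, piTheta u ((μ : ℤ) + 1 - (i + 1 + k : ℕ)) * normAmp u g μ L) +
      tailSum K (fun k L => (2 * (k : ℝ) + 1) *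
        shiftDown (fun m => normAmp u g m L) (i + k)) := by
    rw [← tailSum_mul_left, ← tailSum_mul_left, ← tailSum_add]
    refine tailSum_congr fun k L _ => ?_
    have hL : (Function.support fun μ => normAmp u g μ L).Finite := by
      refine (Finset.finite_toSet (Finset.range (3 * g + L.card))).subset fun μ hμ => ?_
      by_contra hne
      refine hμ (normAmp_support hu _ _ _ ?_)
      simp at hne
      omega
    have := finsum_piTheta_single hu (i + k) (fun μ => normAmp u g μ L) hL
    rw [show i + k + 1 = i + 1 + k by ring] at this
    linear_combination (2 * (k : ℝ) + 1) * this
  rw [normAmp_rec hu g i K h h03 h11, normAmp_rec hu g (i + 1) K h h03 h11]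
  linear_combination hT + 1 / 2 * hP

theorem isHeadRecursive_normAmp {u : ℝ} (hu : u ≠ 0) : IsHeadRecursive u (normAmp u) where
  support := normAmp_support hu
  head g i K := by
    have hT : ∀ (_ : 2 * g + K.card ≤ 2), tailSum K (fun k L => (2 * (k : ℝ) + 1) *
        shiftDown (fun m => normAmp u g m L) (i + k)) = 0 := by
      intro hst
      rw [← tailSum_const_zero K]
      refine tailSum_congr fun k L hL => ?_
      rw [← hL, Multiset.card_cons] at hst
      rcases i + k with _ | m
      · simp
      · rw [shiftDown_succ, normAmp_unstable u g m L (by omega), mul_zero]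
    have hP : ∀ (_ : 2 * g + K.card ≤ 2),
        pairSum (fun μ ν => quadTerm (normAmp u) g μ ν K) i = 0 := by
      intro hst
      refine pairSum_eq_zero (fun μ ν => quadTerm_eq_zero (fun hg => ?_)
        fun a b I J hab hIJ => ?_) i
      · exact normAmp_unstable u _ _ _ (by simp; omega)
      · have hc : I.card + J.card = K.card := by rw [← hIJ, Multiset.card_add]
        by_cases hI : 2 * a + I.card ≤ 1
        · exact Or.inl (normAmp_unstable u _ _ _ hI)
        · exact Or.inr (normAmp_unstable u _ _ _ (by omega))
    by_cases hst : 2 * g + K.card ≤ 1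
    · have h1 : ¬(g = 0 ∧ i = 0 ∧ K = {0, 0}) := by
        rintro ⟨rfl, -, rfl⟩
        simp at hst
      rw [normAmp_unstable u g i K hst, normAmp_unstable u g (i + 1) K hst, hT (by omega),
        hP (by omega), if_neg h1, if_neg (by omega)]
      ring
    by_cases h03 : g = 0 ∧ K.card = 2
    · obtain ⟨rfl, h2⟩ := h03
      rw [hT (by omega), hP (by omega)]
      obtain ⟨j, k, rfl⟩ := Multiset.card_eq_two.mp h2
      rw [normAmp_three hu, normAmp_three hu, if_neg (by omega : ¬(i + 1 = 0 ∧ j = 0 ∧ k = 0)),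
        if_neg (by omega : ¬(0 = 1 ∧ i = 1 ∧ ({j, k} : Multiset ℕ) = 0))]
      have : ({j, k} : Multiset ℕ) = {0, 0} ↔ j = 0 ∧ k = 0 := by
        rw [show ({j, k} : Multiset ℕ) = j ::ₘ {k} from rfl, cons_eq_pair_zero_iff,
          Multiset.singleton_inj]
      simp only [this, true_and]
      split_ifs
      · field_simp
        ring
      · ring
    by_cases h11 : g = 1 ∧ K.card = 0
    · obtain ⟨rfl, h0⟩ := h11
      rw [hT (by omega), hP (by omega)]
      obtain rfl := Multiset.card_eq_zero.mp h0
      rw [normAmp_torus hu, normAmp_torus hu, if_neg (by omega)]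
      have := piTheta_recursion hu (1 - i)
      rw [show (1 - (i : ℤ) - 1) = 1 - ((i + 1 : ℕ) : ℤ) by push_cast; ring] at this
      have e : (if (1 : ℕ) = 1 ∧ i = 1 ∧ (0 : Multiset ℕ) = 0 then (1 / 8 : ℝ) else 0) =
          1 / 8 * (if (1 - (i : ℤ)) = 0 then 1 else 0) := by
        by_cases hi : i = 1
        · simp [hi]
        · rw [if_neg (by tauto), if_neg (by omega), mul_zero]
      rw [e]
      linear_combination 1 / 8 * this
    have h1 : ¬(g = 0 ∧ i = 0 ∧ K = {0, 0}) := by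
      rintro ⟨rfl, -, rfl⟩
      exact h03 ⟨rfl, rfl⟩
    have h2 : ¬(g = 1 ∧ i = 1 ∧ K = 0) := by
      rintro ⟨rfl, -, rfl⟩
      exact h11 ⟨rfl, rfl⟩
    rw [normAmp_head_of_stable hu g i K (by omega) h03 h11, if_neg h1, if_neg h2]
    ring

theorem pow_mul_factorial_div_le {x : ℝ} (hx : 0 ≤ x) (hx1 : x ≤ 1) (m j : ℕ) :
    x ^ j * ((m + j).factorial / j.factorial) * (1 - x) ^ m ≤ m.factorial := by
  have h1 : x ^ j * (1 - x) ^ m * ((m + j).choose j : ℝ) ≤ 1 := by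
    have h := add_pow x (1 - x) (m + j)
    rw [add_sub_cancel, one_pow] at h
    have := Finset.single_le_sum (f := fun k => x ^ k * (1 - x) ^ (m + j - k) *
      ((m + j).choose k : ℝ)) (s := Finset.range (m + j + 1)) (a := j)
      (fun k _ => mul_nonneg (mul_nonneg (pow_nonneg hx _) (pow_nonneg (by linarith) _))
        (Nat.cast_nonneg _)) (by simp)
    refine le_trans ?_ h.ge
    simpa using this
  have h2 : ((m + j).factorial / j.factorial : ℝ) = (m + j).choose j * m.factorial := by
    rw [Nat.add_comm m j, Nat.cast_add_choose]
    field_simp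
  rw [h2]
  calc x ^ j * ((m + j).choose j * m.factorial) * (1 - x) ^ m
      = x ^ j * (1 - x) ^ m * ((m + j).choose j : ℝ) * m.factorial := by ring
    _ ≤ 1 * m.factorial := by gcongr
    _ = m.factorial := one_mul _

theorem ampBound_mul_le {t : ℝ} (ht : 0 < t) (ht1 : 6 / 5 * t ≤ 1) (h n j : ℕ) :
    ampBound t h n j * (1 - 6 / 5 * t) ^ (2 * h + n) ≤
      (9 / 4) ^ h * t ^ (2 * h + n) * 3 ^ n * (2 * h + n).factorial := by
  have := pow_mul_factorial_div_le (by positivity : 0 ≤ 6 / 5 * t) ht1 (2 * h + n) j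
  calc ampBound t h n j * (1 - 6 / 5 * t) ^ (2 * h + n)
      = (9 / 4) ^ h * t ^ (2 * h + n) * 3 ^ n * ((6 / 5 * t) ^ j *
        ((2 * h + n + j).factorial / j.factorial) * (1 - 6 / 5 * t) ^ (2 * h + n)) := by
        rw [ampBound, mul_pow]
        ring
    _ ≤ _ := by gcongr

theorem exists_cube_mul_pow_le {y : ℝ} (hy : 0 < y) (hy1 : y < 1) :
    ∃ C : ℝ, 0 < C ∧ ∀ h : ℕ, ((h : ℝ) + 1) ^ 3 * y ^ h ≤ C := by
  obtain ⟨B, hB⟩ := (tendsto_pow_const_mul_const_pow_of_abs_lt_one 3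
    (r := y) (by rwa [abs_of_pos hy])).bddAbove_range
  have hB' : ∀ n : ℕ, (n : ℝ) ^ 3 * y ^ n ≤ B := fun n => hB ⟨n, rfl⟩
  have hBpos : 0 < B := lt_of_lt_of_le (by simpa using hy) (hB' 1)
  refine ⟨B / y, by positivity, fun h => ?_⟩
  rw [le_div_iff₀ hy]
  have := hB' (h + 1)
  push_cast at this
  rwa [pow_succ y h, ← mul_assoc] at this

theorem central_trinomial_le (h : ℕ) :
    (27 / 4 : ℝ) ^ h * ((2 * h).factorial * h.factorial) ≤
      ((h : ℝ) + 1) ^ 2 * (3 * h).factorial := by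
  induction h with
  | zero => simp
  | succ h ih =>
    rw [show 2 * (h + 1) = 2 * h + 1 + 1 by ring, show 3 * (h + 1) = 3 * h + 1 + 1 + 1 by ring,
      Nat.factorial_succ (2 * h + 1), Nat.factorial_succ (2 * h), Nat.factorial_succ h,
      Nat.factorial_succ (3 * h + 1 + 1), Nat.factorial_succ (3 * h + 1), Nat.factorial_succ (3 * h)]
    push_cast
    set F : ℝ := Nat.cast (3 * h).factorial
    have hF : 0 ≤ F := by positivity
    calc (27 / 4 : ℝ) ^ (h + 1) * ((2 * (h : ℝ) + 1 + 1) * ((2 * h + 1) * (2 * h).factorial) *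
          (((h : ℝ) + 1) * h.factorial))
        = 27 / 4 * (2 * h + 2) * (2 * h + 1) * (h + 1) *
          ((27 / 4 : ℝ) ^ h * ((2 * h).factorial * h.factorial)) := by ring
      _ ≤ 27 / 4 * (2 * h + 2) * (2 * h + 1) * (h + 1) * (((h : ℝ) + 1) ^ 2 * F) := by gcongr
      _ ≤ _ := by
        have hh : (0 : ℝ) ≤ h := Nat.cast_nonneg h
        have key : 27 / 4 * (2 * (h : ℝ) + 2) * (2 * h + 1) * (h + 1) * ((h : ℝ) + 1) ^ 2 ≤
            ((h : ℝ) + 1 + 1) ^ 2 * ((3 * h + 1 + 1 + 1) * ((3 * h + 1 + 1) * (3 * h + 1))) := by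
          have h2 : 0 ≤ (h : ℝ) ^ 2 := by positivity
          have h3 : 0 ≤ (h : ℝ) ^ 3 := by positivity
          have h4 : 0 ≤ (h : ℝ) ^ 4 := by positivity
          nlinarith
        calc _ = 27 / 4 * (2 * (h : ℝ) + 2) * (2 * h + 1) * (h + 1) * ((h : ℝ) + 1) ^ 2 * F := by
              ring
          _ ≤ ((h : ℝ) + 1 + 1) ^ 2 * ((3 * h + 1 + 1 + 1) * ((3 * h + 1 + 1) * (3 * h + 1))) * F :=
              by gcongr
          _ = _ := by ring

theorem factorial_ratio_le (h n : ℕ) :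
    ((2 * h + n).factorial : ℝ) * (3 * h).factorial ≤ (3 * h + n).factorial * (2 * h).factorial := by
  induction n with
  | zero => rw [add_zero, add_zero, mul_comm]
  | succ n ih =>
    rw [← add_assoc, ← add_assoc, Nat.factorial_succ, Nat.factorial_succ]
    push_cast
    have hh : (0 : ℝ) ≤ h := Nat.cast_nonneg h
    calc (2 * (h : ℝ) + n + 1) * (2 * h + n).factorial * (3 * h).factorial
        = (2 * (h : ℝ) + n + 1) * ((2 * h + n).factorial * (3 * h).factorial) := by ring
      _ ≤ (3 * (h : ℝ) + n + 1) * ((3 * h + n).factorial * (2 * h).factorial) := by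
        gcongr
        norm_num
      _ = _ := by ring

theorem poly_factorial_le (h n : ℕ) :
    (27 / 4 : ℝ) ^ h * ((2 * h + n).factorial * (h + 1).factorial) ≤
      ((h : ℝ) + 1) ^ 3 * (3 * h + n).factorial := by
  have h1 := central_trinomial_le h
  have h2 := factorial_ratio_le h n
  have h3 : (0 : ℝ) < (3 * h).factorial := by positivity
  refine le_of_mul_le_mul_right ?_ h3
  rw [Nat.factorial_succ]
  push_cast
  calc (27 / 4 : ℝ) ^ h * ((2 * h + n).factorial * (((h : ℝ) + 1) * h.factorial)) * (3 * h).factorial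
      = (27 / 4 : ℝ) ^ h * (((h : ℝ) + 1) * h.factorial) *
        ((2 * h + n).factorial * (3 * h).factorial) := by ring
    _ ≤ (27 / 4 : ℝ) ^ h * (((h : ℝ) + 1) * h.factorial) *
        ((3 * h + n).factorial * (2 * h).factorial) := by gcongr
    _ = ((h : ℝ) + 1) * (3 * h + n).factorial *
        ((27 / 4 : ℝ) ^ h * ((2 * h).factorial * h.factorial)) := by ring
    _ ≤ ((h : ℝ) + 1) * (3 * h + n).factorial * (((h : ℝ) + 1) ^ 2 * (3 * h).factorial) := by gcongr
    _ = _ := by ring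

theorem growthP_pos {u : ℝ} (hu : 0 < u) : 0 < growthP u := by
  unfold growthP
  split_ifs with h
  · positivity
  · exact div_pos (by norm_num) (by linarith)

/-- The majorants grow as claimed, with a constant `S`. -/
def MajorantGrowth (u S : ℝ) : Prop :=
  (∀ h n j : ℕ, j ≤ 3 * h + n → ampBound (1 / (6 * u)) h n j ≤
    S * (2 * u / 27) ^ (h + 1) * growthP u ^ (3 * h + n) *
      ((3 * h + n).factorial / (h + 1).factorial)) ∧
  ∀ c j : ℕ, j ≤ c → 1 / (6 * u) * ampBound (1 / (6 * u)) 0 c j ≤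
    S * growthP u ^ c * c.factorial

theorem majorant_rescale {t y b : ℝ} {C a : ℝ} (ht : t ≠ 0) (hy : y ≠ 0) (hb : b ≠ 0) (h n : ℕ) :
    t ^ (2 * h + n) * 3 ^ n * a * (C + 1 / 81) =
      (81 * t * C + t) * (1 / (81 * t)) ^ (h + 1) * (3 * t / y) ^ (3 * h + n) * (a / b) *
        y ^ (2 * h + n) * (b * 3 ^ h * y ^ h) := by
  have e1 : (3 * t / y) ^ (3 * h + n) * y ^ (2 * h + n) * y ^ h = (3 * t) ^ (3 * h + n) := by
    rw [mul_assoc, ← pow_add, show 2 * h + n + h = 3 * h + n by ring, ← mul_pow,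
      div_mul_cancel₀ _ hy]
  have e2 : (1 / (81 * t)) ^ (h + 1) * (81 * t) ^ (h + 1) = 1 := by
    rw [← mul_pow, one_div_mul_cancel (by positivity), one_pow]
  have e3 : (3 * t) ^ (3 * h + n) * 3 ^ h * t = t ^ (2 * h + n) * 3 ^ n * (81 * t) ^ (h + 1) / 81 := by
    have e : (81 : ℝ) ^ h = 3 ^ (4 * h) := by
      rw [pow_mul]
      norm_num
    rw [mul_pow, mul_pow, pow_succ (81 : ℝ), e]
    ring
  have e4 : a / b * b = a := div_mul_cancel₀ _ hb
  calc t ^ (2 * h + n) * 3 ^ n * a * (C + 1 / 81)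
      = (81 * C + 1) * a * (t ^ (2 * h + n) * 3 ^ n / 81) *
        ((1 / (81 * t)) ^ (h + 1) * (81 * t) ^ (h + 1)) := by rw [e2]; ring
    _ = (81 * C + 1) * (1 / (81 * t)) ^ (h + 1) * (a / b * b) *
        (t ^ (2 * h + n) * 3 ^ n * (81 * t) ^ (h + 1) / 81) := by rw [e4]; ring
    _ = (81 * C + 1) * (1 / (81 * t)) ^ (h + 1) * (a / b * b) * 3 ^ h * t *
        ((3 * t / y) ^ (3 * h + n) * y ^ (2 * h + n) * y ^ h) := by rw [← e3, e1]; ring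
    _ = _ := by ring

theorem majorantGrowth_of_ge {u : ℝ} (hu : 2 / 5 ≤ u) : ∃ S, 0 < S ∧ MajorantGrowth u S := by
  have hu0 : 0 < u := by linarith
  set t := 1 / (6 * u) with htdef
  have ht : 0 < t := by positivity
  set y := 1 - 6 / 5 * t with hy
  have hx : 6 / 5 * t = 1 / (5 * u) := by rw [htdef]; field_simp
  have hx1 : 6 / 5 * t ≤ 1 / 2 := by
    rw [hx, div_le_div_iff₀ (by positivity) (by norm_num)]
    linarith
  have hy0 : 0 < y := by linarith
  have hy1 : y < 1 := by linarith
  have hP : growthP u = 3 * t / y := by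
    rw [growthP, if_neg (by linarith), hy, hx, htdef]
    have : 10 * u - 2 ≠ 0 := by
      have : 0 < 10 * u - 2 := by linarith
      exact this.ne'
    have h5 : 1 - 1 / (5 * u) = (10 * u - 2) / (10 * u) := by
      field_simp
      ring
    rw [h5]
    field_simp
    norm_num
  have hut : 2 * u / 27 = 1 / (81 * t) := by
    rw [htdef]
    field_simp
    norm_num
  obtain ⟨C, hC, hCb⟩ := exists_cube_mul_pow_le hy0 hy1
  refine ⟨81 * t * C + t, by positivity, fun h n j _ => ?_, fun c j _ => ?_⟩
  · have h1 := ampBound_mul_le ht (by linarith) h n j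
    have h2 := poly_factorial_le h n
    have h3 := hCb h
    rw [← hy] at h1
    rw [hP, hut]
    have hyp : 0 < y ^ (2 * h + n) := by positivity
    refine le_of_mul_le_mul_right (h1.trans ?_) hyp
    have hfac : (0 : ℝ) < (h + 1).factorial := by positivity
    refine le_of_mul_le_mul_right ?_ (by positivity : (0 : ℝ) < (h + 1).factorial * (3 : ℝ) ^ h * y ^ h)
    calc (9 / 4) ^ h * t ^ (2 * h + n) * 3 ^ n * ((2 * h + n).factorial : ℝ) *
          ((h + 1).factorial * (3 : ℝ) ^ h * y ^ h)
        = t ^ (2 * h + n) * 3 ^ n * y ^ h * ((27 / 4 : ℝ) ^ h *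
          ((2 * h + n).factorial * (h + 1).factorial)) := by
          rw [show (27 / 4 : ℝ) = 9 / 4 * 3 by norm_num, mul_pow]
          ring
      _ ≤ t ^ (2 * h + n) * 3 ^ n * y ^ h * (((h : ℝ) + 1) ^ 3 * (3 * h + n).factorial) := by
          gcongr
      _ = t ^ (2 * h + n) * 3 ^ n * (3 * h + n).factorial * (((h : ℝ) + 1) ^ 3 * y ^ h) := by ring
      _ ≤ t ^ (2 * h + n) * 3 ^ n * (3 * h + n).factorial * C := by gcongr
      _ ≤ t ^ (2 * h + n) * 3 ^ n * (3 * h + n).factorial * (C + 1 / 81) := by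
          gcongr
          linarith
      _ = (81 * t * C + t) * (1 / (81 * t)) ^ (h + 1) * (3 * t / y) ^ (3 * h + n) *
          ((3 * h + n).factorial / (h + 1).factorial) * y ^ (2 * h + n) *
          ((h + 1).factorial * 3 ^ h * y ^ h) := by
          exact majorant_rescale ht.ne' hy0.ne' hfac.ne' h n
  · have h1 := ampBound_mul_le ht (by linarith) 0 c j
    rw [← hy] at h1
    simp only [mul_zero, zero_add, pow_zero, one_mul] at h1
    rw [hP, div_pow]
    have h2 : ampBound t 0 c j ≤ (3 * t) ^ c / y ^ c * c.factorial := by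
      rw [div_mul_eq_mul_div, le_div_iff₀ (by positivity), mul_pow]
      linarith
    calc t * ampBound t 0 c j ≤ t * ((3 * t) ^ c / y ^ c * c.factorial) := by gcongr
      _ ≤ (81 * t * C + t) * ((3 * t) ^ c / y ^ c * c.factorial) := by
        gcongr
        have : 0 < 81 * t * C := by positivity
        linarith
      _ = _ := by ring

theorem ampBound_scale (s t : ℝ) (h n j : ℕ) :
    ampBound (s * t) h n j = s ^ (2 * h + n + j) * ampBound t h n j := by
  rw [ampBound, ampBound, mul_pow]
  ring

theorem exists_majorantGrowth {u : ℝ} (hu : 0 < u) : ∃ S, 0 < S ∧ MajorantGrowth u S := by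
  rcases le_or_gt (2 / 5) u with h | hlt
  · exact majorantGrowth_of_ge h
  obtain ⟨S, hS, hS1, hS2⟩ := majorantGrowth_of_ge (u := 2 / 5) le_rfl
  set s := 2 / 5 / u with hs
  have hs1 : 1 ≤ s := by
    rw [hs, le_div_iff₀ hu]
    linarith
  have hs0 : 0 < s := by linarith
  have hu' : u = 2 / 5 / s := by
    rw [hs]
    field_simp
  have ht : 1 / (6 * u) = s * (1 / (6 * (2 / 5))) := by
    rw [hs]
    field_simp
  have hP : growthP u = s ^ 2 * growthP (2 / 5) := by
    rw [growthP, growthP, if_pos hlt, if_neg (lt_irrefl _), hs]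
    field_simp
    norm_num
  refine ⟨s * S, by positivity, fun h n j hj => ?_, fun c j hj => ?_⟩
  · rw [ht, ampBound_scale]
    have hb := hS1 h n j hj
    have hnn := ampBound_nonneg (by norm_num : (0 : ℝ) ≤ 1 / (6 * (2 / 5))) h n j
    calc s ^ (2 * h + n + j) * ampBound (1 / (6 * (2 / 5))) h n j
        ≤ s ^ (2 * h + n + (3 * h + n)) * ampBound (1 / (6 * (2 / 5))) h n j := by
          gcongr
      _ ≤ s ^ (2 * h + n + (3 * h + n)) * (S * (2 * (2 / 5) / 27) ^ (h + 1) *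
          growthP (2 / 5) ^ (3 * h + n) * ((3 * h + n).factorial / (h + 1).factorial)) := by gcongr
      _ = _ := by
        have e : s ^ (2 * h + n + (3 * h + n)) * s ^ (h + 1) = s * (s ^ 2) ^ (3 * h + n) := by
          generalize s = s
          ring
        have e' : (2 * u / 27) ^ (h + 1) * s ^ (h + 1) = (2 * (2 / 5) / 27) ^ (h + 1) := by
          rw [← mul_pow, hs]
          congr 1
          field_simp
        rw [hP, mul_pow, ← e']
        linear_combination (S * (2 * u / 27) ^ (h + 1) * growthP (2 / 5) ^ (3 * h + n) *
          ((3 * h + n).factorial / (h + 1).factorial)) * e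
  · rw [ht, ampBound_scale]
    have hb := hS2 c j hj
    have hnn := ampBound_nonneg (by norm_num : (0 : ℝ) ≤ 1 / (6 * (2 / 5))) 0 c j
    calc s * (1 / (6 * (2 / 5))) * (s ^ (2 * 0 + c + j) * ampBound (1 / (6 * (2 / 5))) 0 c j)
        = s ^ (c + j + 1) * (1 / (6 * (2 / 5)) * ampBound (1 / (6 * (2 / 5))) 0 c j) := by
          rw [mul_zero, zero_add]
          ring
      _ ≤ s ^ (c + c + 1) * (1 / (6 * (2 / 5)) * ampBound (1 / (6 * (2 / 5))) 0 c j) := by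
          gcongr
      _ ≤ s ^ (c + c + 1) * (S * growthP (2 / 5) ^ c * c.factorial) := by gcongr
      _ = _ := by
        rw [hP, mul_pow]
        generalize s = s
        ring

theorem F_mul_prod {u : ℝ} (hu : u ≠ 0) (g n : ℕ) (k : Fin (n + 1) → ℕ) :
    (painleveI u).F g k * ∏ i, (((2 * k i + 1)‼ : ℕ) : ℝ) =
      normAmp u g (k 0) (List.ofFn fun i : Fin n => k i.succ : List ℕ) := by
  rw [OnePointCurve.F, if_neg (Nat.succ_ne_zero n), List.ofFn_succ,
    AiryTensors.amplitude_eq_headAmplitude _ (airy_A_comm hu), normAmp, Fin.prod_univ_succ,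
    Multiset.map_coe, Multiset.prod_coe, List.map_ofFn, List.prod_ofFn]
  rfl

theorem primitive_monomial {R : Type*} [Field R] (n : ℕ) (c : R) :
    primitive (PowerSeries.monomial n c) = PowerSeries.monomial (n + 1) (c / (n + 1 : ℕ)) := by
  ext m
  rw [primitive, PowerSeries.coeff_mk, PowerSeries.coeff_monomial, PowerSeries.coeff_monomial]
  rcases m with _ | m
  · simp
  · by_cases h : m = n
    · subst h
      simp
    · simp [h]

theorem primitive_sub {R : Type*} [Field R] (f g : R⟦X⟧) :
    primitive (f - g) = primitive f - primitive g := by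
  ext m
  simp only [primitive, PowerSeries.coeff_mk, map_sub]
  split_ifs
  · simp
  · rw [sub_div]

theorem primitive_ydx (u : ℝ) :
    primitive ((painleveI u).y * PowerSeries.derivative ℝ (painleveI u).x) =
      PowerSeries.monomial 5 (2 / 5) - PowerSeries.monomial 3 (2 * u) := by
  have h : (painleveI u).y * PowerSeries.derivative ℝ (painleveI u).x =
      PowerSeries.monomial 4 2 - PowerSeries.monomial 2 (6 * u) := by
    have h2 : PowerSeries.derivative ℝ (painleveI u).x = 2 * PowerSeries.X := by
      simp [OnePointCurve.x, PowerSeries.derivative_C, PowerSeries.derivative_X]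
    have h6 : (PowerSeries.C (6 * u) : ℝ⟦X⟧) = PowerSeries.C (3 * u) * 2 := by
      rw [show 6 * u = 3 * u * 2 by ring, map_mul, map_ofNat]
    have h2' : (PowerSeries.C 2 : ℝ⟦X⟧) = 2 := map_ofNat _ _
    have hm : ∀ (n : ℕ) (c : ℝ),
        PowerSeries.monomial n c = PowerSeries.C c * (PowerSeries.X : ℝ⟦X⟧) ^ n := by
      intro n c
      ext m
      rw [PowerSeries.coeff_C_mul_X_pow, PowerSeries.coeff_monomial]
    rw [h2, hm, hm, h6, h2']
    simp only [painleveI]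
    ring
  rw [h, primitive_sub, primitive_monomial, primitive_monomial]
  norm_num
  congr 2
  ring

theorem amplitude_mul_dfWeight {u : ℝ} (g i : ℕ) :
    (painleveI u).airy.amplitude g [i] * dfWeight i = normAmp u g i 0 := by
  rw [normAmp, AiryTensors.headAmplitude, Multiset.toList_zero]
  simp

theorem omega1_eq_sum {u : ℝ} (hu : u ≠ 0) (g : ℕ) :
    (painleveI u).omega1 g = ∑ i ∈ Finset.range (3 * g),
      HahnSeries.single (-(2 * (i : ℤ) + 2)) (normAmp u g i 0) := by
  have hterm : ∀ i, (painleveI u).airy.amplitude g [i] • (painleveI u).xi i =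
      HahnSeries.single (-(2 * (i : ℤ) + 2)) (normAmp u g i 0) := by
    intro i
    rw [xi_painleveI, ← amplitude_mul_dfWeight]
    ext m
    rw [HahnSeries.coeff_smul, HahnSeries.coeff_single, HahnSeries.coeff_single, smul_ite, smul_zero]
    rfl
  rw [OnePointCurve.omega1, finsum_congr hterm]
  refine finsum_eq_sum_of_support_subset _ fun i hi => ?_
  rw [Finset.coe_range, Set.mem_Iio]
  by_contra hge
  refine hi ?_
  beta_reduce
  rw [normAmp_support hu g i 0 (by simp; omega), HahnSeries.single_eq_zero]

theorem omega1_coeff {u : ℝ} (hu : u ≠ 0) (g m : ℕ) :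
    ((painleveI u).omega1 g).coeff (-(2 * (m : ℤ) + 2)) = normAmp u g m 0 := by
  rw [omega1_eq_sum hu, HahnSeries.coeff_sum]
  by_cases hm : m < 3 * g
  · rw [Finset.sum_eq_single_of_mem m (Finset.mem_range.mpr hm)]
    · rw [HahnSeries.coeff_single_same]
    · intro b _ hb
      exact HahnSeries.coeff_single_of_ne (by omega)
  · rw [normAmp_support hu g m 0 (by simp; omega)]
    refine Finset.sum_eq_zero fun b hb => HahnSeries.coeff_single_of_ne ?_
    rw [Finset.mem_range] at hb
    omega

theorem freeEnergy_eq {u : ℝ} (hu : u ≠ 0) (h : ℕ) (hh : 1 ≤ h) :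
    (painleveI u).freeEnergy (h + 1) = 2 * u / (5 * h) * normAmp u (h + 1) 1 0 := by
  have hrec := (isHeadRecursive_normAmp hu).head (h + 1) 1 0
  rw [tailSum_zero, pairSum_one, if_neg (by simp),
    if_neg (by omega)] at hrec
  have hres : residue ((primitive ((painleveI u).y * PowerSeries.derivative ℝ (painleveI u).x) :
      ℝ⸨X⸩) * (painleveI u).omega1 (h + 1)) =
      2 / 5 * normAmp u (h + 1) 2 0 - 2 * u * normAmp u (h + 1) 1 0 := by
    rw [primitive_ydx, map_sub, ofPowerSeries_monomial, ofPowerSeries_monomial, sub_mul, residue,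
      HahnSeries.coeff_sub, ← omega1_coeff hu, ← omega1_coeff hu]
    congr 1
    · have := HahnSeries.coeff_single_mul_add (r := (2 / 5 : ℝ))
        (x := (painleveI u).omega1 (h + 1)) (a := -6) (b := 5)
      simpa using this
    · have := HahnSeries.coeff_single_mul_add (r := 2 * u)
        (x := (painleveI u).omega1 (h + 1)) (a := -4) (b := 3)
      simpa using this
  rw [OnePointCurve.freeEnergy, hres]
  have h0 : (h : ℝ) ≠ 0 := by positivity
  have h2 : normAmp u (h + 1) 2 0 = 3 * u * normAmp u (h + 1) 1 0 := by
    norm_num at hrec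
    linarith
  rw [h2]
  push_cast
  rw [show 2 - 2 * ((h : ℝ) + 1) = -(2 * h) by ring]
  field_simp
  ring

theorem freeEnergy_le {u S : ℝ} (hu : 0 < u) (hS : 0 < S) (hM : MajorantGrowth u S) (h : ℕ)
    (hh : 1 ≤ h) :
    (painleveI u).freeEnergy (h + 1) ≤ S * (8 / 5 * u * growthP u) * (2 * u / 27) ^ (h + 1) *
      growthP u ^ (3 * h) * ((3 * h).factorial / (h + 1).factorial) := by
  have hP := growthP_pos hu
  have h1 := (isHeadRecursive_normAmp hu.ne').le_ampBound hu h 1 0 (3 * h) (by simp; ring)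
  have h2 := h1.trans (hM.1 h 1 (3 * h) (by omega))
  rw [freeEnergy_eq hu.ne' h hh]
  have hh' : (1 : ℝ) ≤ h := by exact_mod_cast hh
  have hratio : 2 * u / (5 * h) * (3 * h + 1) ≤ 8 / 5 * u := by
    rw [div_mul_eq_mul_div, div_le_iff₀ (by positivity)]
    nlinarith
  calc 2 * u / (5 * h) * normAmp u (h + 1) 1 0
      ≤ 2 * u / (5 * h) * (S * (2 * u / 27) ^ (h + 1) * growthP u ^ (3 * h + 1) *
        ((3 * h + 1).factorial / (h + 1).factorial)) := by gcongr
    _ = 2 * u / (5 * h) * (3 * h + 1) * (S * (2 * u / 27) ^ (h + 1) * growthP u ^ (3 * h + 1) *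
        ((3 * h).factorial / (h + 1).factorial)) := by
        rw [Nat.factorial_succ (3 * h)]
        push_cast
        ring
    _ ≤ 8 / 5 * u * (S * (2 * u / 27) ^ (h + 1) * growthP u ^ (3 * h + 1) *
        ((3 * h).factorial / (h + 1).factorial)) := by gcongr
    _ = _ := by ring

theorem normAmp_le {u S : ℝ} (hu : 0 < u) (hS : 0 < S) (hM : MajorantGrowth u S) (g i : ℕ)
    (K : Multiset ℕ) (hst : 1 < 2 * g + K.card) :
    normAmp u g i K ≤ S * (2 * u / 27) ^ g * growthP u ^ (3 * g + (K.card + 1) - 3) *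
      ((3 * g + (K.card + 1) - 3).factorial / g.factorial) := by
  have hP := growthP_pos hu
  have hG := isHeadRecursive_normAmp hu.ne'
  by_cases hsupp : 3 * g + K.card < i + K.sum + 2
  · rw [hG.support g i K hsupp]
    positivity
  rcases g with _ | h
  · obtain ⟨c, hc⟩ : ∃ c, K.card = c + 2 := ⟨K.card - 2, by omega⟩
    obtain ⟨j, hj⟩ : ∃ j, i + K.sum + j = c := ⟨c - (i + K.sum), by omega⟩
    refine ((hG.genus_zero_le hu i K c j hc hj).trans (hM.2 c j (by omega))).trans_eq ?_
    rw [show 3 * 0 + (K.card + 1) - 3 = c by omega]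
    simp
  · obtain ⟨j, hj⟩ : ∃ j, i + K.sum + j = 3 * h + 1 + K.card :=
      ⟨3 * h + 1 + K.card - (i + K.sum), by omega⟩
    refine (hG.le_ampBound hu h i K j hj).trans ((hM.1 h (K.card + 1) j (by omega)).trans_eq ?_)
    rw [show 3 * (h + 1) + (K.card + 1) - 3 = 3 * h + (K.card + 1) by omega]

theorem mainTheorem6 :
    ∃ S : ℝ → ℝ, ∀ u : ℝ, 0 < u → 0 < S u ∧ 0 < growthP u ∧
      ∀ (g n : ℕ), 2 < 2 * g + n → ∀ k : Fin n → ℕ,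
        (painleveI u).F g k * ∏ i, (((2 * k i + 1)‼ : ℕ) : ℝ) ≤
          S u * (2 * u / 27) ^ g * growthP u ^ (3 * g + n - 3) *
            ((3 * g + n - 3).factorial / g.factorial : ℝ) := by
  choose! S hS hM using fun (u : ℝ) (hu : 0 < u) => exists_majorantGrowth hu
  refine ⟨fun u => S u * (1 + 8 / 5 * u * growthP u), fun u hu => ?_⟩
  have hP := growthP_pos hu
  have hSu := hS u hu
  refine ⟨by positivity, hP, fun g n hst k => ?_⟩
  have hx : 0 < 8 / 5 * u * growthP u := by positivity
  rcases n with _ | n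
  · obtain ⟨h, rfl⟩ : ∃ h, g = h + 1 := ⟨g - 1, by omega⟩
    have hle := freeEnergy_le hu hSu (hM u hu) h (by omega)
    rw [OnePointCurve.F, if_pos rfl, Finset.univ_eq_empty, Finset.prod_empty, mul_one,
      show 3 * (h + 1) + 0 - 3 = 3 * h by omega]
    refine hle.trans ?_
    gcongr
    linarith
  · rw [F_mul_prod hu.ne']
    have hle := normAmp_le hu hSu (hM u hu) g (k 0) (List.ofFn fun i : Fin n => k i.succ : List ℕ)
      (by simp; omega)
    rw [Multiset.coe_card, List.length_ofFn] at hle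
    refine hle.trans ?_
    gcongr
    exact le_mul_of_one_le_right hSu.le (by linarith)
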